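/- For $A\in\mathbb R^{m\times n}$ and an integer $0\le k\le\min\{m,n\}$ let \[ \operatorname{maxdet}_k(A)=\max\bigl\{\,|\det(A_{I,J})| : I\subseteq[m],\ J\subseteq[n],\ |I|=|J|=k\,\bigr\}. \] For pairs $S=(I,J)$, $T=(I',J')$ of $k$-element index sets write $A_S=A_{I,J}$ and $d(S,T)=\tfrac12|I\,\triangle\, I'|+\tfrac12|J\,\triangle\, J'|$, the number of rows and columns replaced in going from $S$ to $T$. There are an absolute constant $C$ and an algorithm (a program for the unit-cost real RAM: arithmetic operations and comparisons on real numbers, addition, truncated subtraction and comparison on integers, and memory accesses each take one step) which, for all $m,n$, all $k\le\min\{m,n\}$ and all $A\in\mathbb R^{m\times n}$, on input $(m,n,k,A)$ halts after at most $C(m+n+1)^C$ steps and outputs $S=(I,J)$ with $I\subseteq[m]$, $J\subseteq[n]$, $|I|=|J|=k$ and \[ k^{Ck}\cdot|\det(A_{I,J})|\ \ge\ \operatorname{maxdet}_k(A) \qquad(\text{with } 0^0=1). \] Moreover, the algorithm consists of two consecutive phases. The first ends with a pair $S_0$ with $(m+n)^{Ck}\,|\det(A_{S_0})|\ge\operatorname{maxdet}_k(A)$.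 The second leads from $S_0$ to the output by a local search: there is a finite sequence $S_0,S_1,\dots,S_\ell=S$ in which every step satisfies $d(S_i,S_{i+1})\le 2$ and $\tfrac12|\det(A_{S_{i+1}})|>|\det(A_{S_i})|$, and $S$ is a $(2,\tfrac12)$-local maximum, that is, $|\det(A_S)|\ge\tfrac12|\det(A_T)|$ for all $T$ with $d(S,T)\le2$. -/

import Mathlib

/-! ### The unit-cost real RAM

A real RAM has an integer memory and a real memory.  Integers can be added, subtracted (truncated at
zero) and compared, and serve as addresses; reals can be added, subtracted, multiplied, divided and
compared.  The only real constants are `0` and `1`, and no operation turns a real into an integer.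
Each memory is organised as scalar variables and arrays; a program mentions only finitely many of
their names.  Every node of an expression or of a test that is evaluated, and every store, costs one
step. -/

namespace RealRAM

/-- A memory configuration: integer variables, real variables, integer arrays, real arrays
(`iarr a i` is entry `i` of array number `a`). -/
@[ext] structure State where
  ivar : ℕ → ℕ
  rvar : ℕ → ℝ
  iarr : ℕ → ℕ → ℕ
  rarr : ℕ → ℕ → ℝ

/-- Integer expressions. -/
inductive IExp where
  | const (c : ℕ)
  | var (x : ℕ)
  | arr (a : ℕ) (i : IExp)
  | add (e f : IExp)
  | sub (e f : IExp)

/-- Real expressions. -/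
inductive RExp where
  | zero
  | one
  | var (x : ℕ)
  | arr (a : ℕ) (i : IExp)
  | add (e f : RExp)
  | sub (e f : RExp)
  | mul (e f : RExp)
  | div (e f : RExp)

/-- Tests. -/
inductive Test where
  | ilt (e f : IExp)
  | rlt (e f : RExp)
  | not (b : Test)
  | and (b c : Test)

/-- Programs. -/
inductive Prog where
  | skip
  | iset (x : ℕ) (e : IExp)
  | rset (x : ℕ) (e : RExp)
  | iput (a : ℕ) (i : IExp) (e : IExp)
  | rput (a : ℕ) (i : IExp) (e : RExp)
  | seq (p q : Prog)
  | ite (b : Test) (p q : Prog)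
  | loop (b : Test) (p : Prog)

namespace IExp

/-- The value of an integer expression. -/
def eval (s : State) : IExp → ℕ
  | const c => c
  | var x => s.ivar x
  | arr a i => s.iarr a (i.eval s)
  | add e f => e.eval s + f.eval s
  | sub e f => e.eval s - f.eval s

/-- The number of steps that the evaluation takes. -/
def cost : IExp → ℕ
  | const _ => 1
  | var _ => 1
  | arr _ i => i.cost + 1
  | add e f => e.cost + f.cost + 1
  | sub e f => e.cost + f.cost + 1

end IExp

namespace RExp

/-- The value of a real expression (division by zero returns zero). -/
noncomputable def eval (s : State) : RExp → ℝ
  | zero => 0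
  | one => 1
  | var x => s.rvar x
  | arr a i => s.rarr a (i.eval s)
  | add e f => e.eval s + f.eval s
  | sub e f => e.eval s - f.eval s
  | mul e f => e.eval s * f.eval s
  | div e f => e.eval s / f.eval s

/-- The number of steps that the evaluation takes. -/
def cost : RExp → ℕ
  | zero => 1
  | one => 1
  | var _ => 1
  | arr _ i => i.cost + 1
  | add e f => e.cost + f.cost + 1
  | sub e f => e.cost + f.cost + 1
  | mul e f => e.cost + f.cost + 1
  | div e f => e.cost + f.cost + 1

end RExp

namespace Test

/-- The truth value of a test. -/
def Holds (s : State) : Test → Prop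
  | ilt e f => e.eval s < f.eval s
  | rlt e f => e.eval s < f.eval s
  | not b => ¬ b.Holds s
  | and b c => b.Holds s ∧ c.Holds s

/-- The number of steps that the evaluation takes. -/
def cost : Test → ℕ
  | ilt e f => e.cost + f.cost + 1
  | rlt e f => e.cost + f.cost + 1
  | not b => b.cost + 1
  | and b c => b.cost + c.cost + 1

end Test

/-- `Exec p s t s'`: started in the configuration `s`, the program `p` halts after exactly `t` steps,
in the configuration `s'`. -/
inductive Exec : Prog → State → ℕ → State → Prop where
  | skip (s : State) : Exec Prog.skip s 1 s
  | iset (s : State) (x : ℕ) (e : IExp) :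
      Exec (Prog.iset x e) s (e.cost + 1)
        { s with ivar := Function.update s.ivar x (e.eval s) }
  | rset (s : State) (x : ℕ) (e : RExp) :
      Exec (Prog.rset x e) s (e.cost + 1)
        { s with rvar := Function.update s.rvar x (e.eval s) }
  | iput (s : State) (a : ℕ) (i e : IExp) :
      Exec (Prog.iput a i e) s (i.cost + e.cost + 1)
        { s with iarr := Function.update s.iarr a
                  (Function.update (s.iarr a) (i.eval s) (e.eval s)) }
  | rput (s : State) (a : ℕ) (i : IExp) (e : RExp) :
      Exec (Prog.rput a i e) s (i.cost + e.cost + 1)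
        { s with rarr := Function.update s.rarr a
                  (Function.update (s.rarr a) (i.eval s) (e.eval s)) }
  | seq {p q : Prog} {s s₁ s₂ : State} {t₁ t₂ : ℕ}
      (hp : Exec p s t₁ s₁) (hq : Exec q s₁ t₂ s₂) : Exec (Prog.seq p q) s (t₁ + t₂) s₂
  | ite_true {b : Test} {p q : Prog} {s s' : State} {t : ℕ}
      (hb : b.Holds s) (hp : Exec p s t s') : Exec (Prog.ite b p q) s (b.cost + t) s'
  | ite_false {b : Test} {p q : Prog} {s s' : State} {t : ℕ}
      (hb : ¬ b.Holds s) (hq : Exec q s t s') : Exec (Prog.ite b p q) s (b.cost + t) s'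
  | loop_stop {b : Test} {p : Prog} {s : State}
      (hb : ¬ b.Holds s) : Exec (Prog.loop b p) s b.cost s
  | loop_step {b : Test} {p : Prog} {s s₁ s₂ : State} {t₁ t₂ : ℕ}
      (hb : b.Holds s) (hp : Exec p s t₁ s₁) (hl : Exec (Prog.loop b p) s₁ t₂ s₂) :
      Exec (Prog.loop b p) s (b.cost + t₁ + t₂) s₂

/-- The initial configuration on input `A`, `k`: the integer variables `0`, `1`, `2` hold `m`, `n`,
`k`, the real array `0` holds the entries of `A` row by row (entry `n * i + j` is `A i j`), and
everything else is zero. -/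
noncomputable def input {m n : ℕ} (A : Matrix (Fin m) (Fin n) ℝ) (k : ℕ) : State where
  ivar := fun x => if x = 0 then m else if x = 1 then n else if x = 2 then k else 0
  rvar := fun _ => 0
  iarr := fun _ _ => 0
  rarr := fun a p =>
    if a = 0 then
      if h : p < m * n then
        A (finProdFinEquiv.symm ⟨p, h⟩).1 (finProdFinEquiv.symm ⟨p, h⟩).2
      else 0
    else 0

end RealRAM

/-! ### Square submatrices -/

namespace Subdet

/-- The pairs `(I, J)` of a `k`-element set of row indices and a `k`-element set of column
indices. -/
abbrev Idx (m n k : ℕ) : Type :=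
  {I : Finset (Fin m) // I.card = k} × {J : Finset (Fin n) // J.card = k}

variable {m n k : ℕ}

/-- The determinant of the `k × k` submatrix `A_{I,J}`, rows and columns in increasing order. -/
noncomputable def minor (A : Matrix (Fin m) (Fin n) ℝ) (S : Idx m n k) : ℝ :=
  (A.submatrix (S.1.1.orderEmbOfFin S.1.2) (S.2.1.orderEmbOfFin S.2.2)).det

/-- The largest absolute value of a `k × k` subdeterminant of `A`
(a maximum over a finite set, which is nonempty when `k ≤ m` and `k ≤ n`). -/
noncomputable def maxdet (k : ℕ) (A : Matrix (Fin m) (Fin n) ℝ) : ℝ :=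
  ⨆ S : Idx m n k, |minor A S|

/-- The distance of two index pairs: the number of rows plus the number of columns that have to be
replaced to go from one to the other. -/
def dist (S T : Idx m n k) : ℕ :=
  (symmDiff S.1.1 T.1.1).card / 2 + (symmDiff S.2.1 T.2.1).card / 2

/-- `S` is an `(r, α)`-local maximum. -/
def IsLocalMax (r : ℕ) (α : ℝ) (A : Matrix (Fin m) (Fin n) ℝ) (S : Idx m n k) : Prop :=
  ∀ T : Idx m n k, dist S T ≤ r → α * |minor A T| ≤ |minor A S|

/-- A step of the `α`-local search: `T` results from `S` by replacing up to two rows and columns in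
total, and improves on `S` by a factor of more than `1 / α`. -/
def SearchStep (α : ℝ) (A : Matrix (Fin m) (Fin n) ℝ) (S T : Idx m n k) : Prop :=
  dist S T ≤ 2 ∧ |minor A S| < α * |minor A T|

/-- The index pair `S` is written in the configuration `s`: the first `k` entries of the integer
array `0` list its row indices, those of the integer array `1` its column indices, in any order
(indices start at `0`). -/
def Holds (s : RealRAM.State) (S : Idx m n k) : Prop :=
  (Finset.range k).image (s.iarr 0) = S.1.1.map Fin.valEmbedding ∧
    (Finset.range k).image (s.iarr 1) = S.2.1.map Fin.valEmbedding

end Subdet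

/-! The algorithm works with lists of `k` row and `k` column indices, and evaluates subdeterminants by
Gaussian elimination.

*Local maxima are approximate maxima.* Let `P` be the invertible submatrix at a local maximum, and
`D` another square submatrix, bordered with `P` by the blocks `B` and `C`. Up to sign,
`det D / det P` is the determinant of the pivot transform with blocks `-P⁻¹`, `P⁻¹ B`, `C P⁻¹` and
the Schur complement `D - C P⁻¹ B` (`abs_det_eq_abs_det_mul_abs_det_fromBlocks`). By Cramer's rule the
entries of `P⁻¹ B` and `C P⁻¹` are ratios by which exchanging one column or one row changes the
determinant, and the exchange of one row and one column multiplies it by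
`(P⁻¹ b)_q (c P⁻¹)_p + (P⁻¹)_{qp} y`, with `y` an entry of the Schur complement
(`det_updateRow_updateCol`). Local maximality thus bounds the entries of the mixed blocks by `2` and
the products of an entry of `P⁻¹` with an entry of the Schur complement by `6`. After a scaling of
rows and columns all entries are bounded, and the Leibniz formula gives the factor `(2 k)! 6 ^ k`
(`absDet_le_of_exchangeMax`).

*The crude phase.* The same estimate applies when `D` has one row and column more than `P`: a local
maximum of size `j`, extended by the largest entry of its Schur complement, is within
`(2 j + 1)! 6 ^ j` of the maximum of size `j + 1` (`absDet_succ_le_of_exchangeMax`). The crude phase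
therefore alternates local searches and extensions. Every search starts within a factor
`2 ^ O(k ^ 2)` of its maximum and doubles its value in each successful sweep, so it takes `O(k ^ 2)`
sweeps. For `k = 1` the factor is `1`: the crude phase finds the largest entry, which accounts for
`k ^ (C * k) = 1`. If a subdeterminant of the crude phase vanishes, then so do all of that size and
of larger sizes.

*Running time.* `Prog.time L` bounds the time of a program whose loops make at most `L` iterations
each; it is polynomial in `L` for every program (`Prog.exists_time_le`), and all loops are bounded by
`L = 8 (m + n + 1) ^ 2`. -/

/-! ### Reasoning about programs -/

namespace RealRAM

namespace Prog

/-- An upper bound for the running time of a program none of whose loops makes more than `L`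
iterations each time it is entered. -/
def time (L : ℕ) : Prog → ℕ
  | skip => 1
  | iset _ e => e.cost + 1
  | rset _ e => e.cost + 1
  | iput _ i e => i.cost + e.cost + 1
  | rput _ i e => i.cost + e.cost + 1
  | seq p q => p.time L + q.time L
  | ite b p q => b.cost + (p.time L + q.time L)
  | loop b p => b.cost + L * (b.cost + p.time L)

theorem exists_time_le (p : Prog) : ∃ c e : ℕ, ∀ L, 1 ≤ L → p.time L ≤ c * L ^ e := by
  have const : ∀ c : ℕ, ∃ c' e : ℕ, ∀ L, 1 ≤ L → c ≤ c' * L ^ e :=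
    fun c => ⟨c, 0, fun L _ => by simp⟩
  have add : ∀ f g : ℕ → ℕ, (∃ c e : ℕ, ∀ L, 1 ≤ L → f L ≤ c * L ^ e) →
      (∃ c e : ℕ, ∀ L, 1 ≤ L → g L ≤ c * L ^ e) →
      ∃ c e : ℕ, ∀ L, 1 ≤ L → f L + g L ≤ c * L ^ e := by
    rintro f g ⟨c, e, h⟩ ⟨c', e', h'⟩
    refine ⟨c + c', e + e', fun L hL => ?_⟩
    have h1 : L ^ e ≤ L ^ (e + e') := Nat.pow_le_pow_right hL (by omega)
    have h2 : L ^ e' ≤ L ^ (e + e') := Nat.pow_le_pow_right hL (by omega)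
    calc f L + g L ≤ c * L ^ e + c' * L ^ e' := Nat.add_le_add (h L hL) (h' L hL)
      _ ≤ c * L ^ (e + e') + c' * L ^ (e + e') := by gcongr
      _ = _ := by ring
  induction p with
  | skip => exact const _
  | iset x e => exact const _
  | rset x e => exact const _
  | iput a i e => exact const _
  | rput a i e => exact const _
  | seq p q hp hq => exact add _ _ hp hq
  | ite b p q hp hq => exact add _ _ (const _) (add _ _ hp hq)
  | loop b p hp =>
    refine add _ _ (const _) ?_
    obtain ⟨c, e, h⟩ := add _ _ (const b.cost) hp
    refine ⟨c, e + 1, fun L hL => ?_⟩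
    calc L * (b.cost + p.time L) ≤ L * (c * L ^ e) := by gcongr; exact h L hL
      _ = _ := by ring

/-- Whether the program contains an assignment to the integer variable `x`. -/
def setsIVar (x : ℕ) : Prog → Bool
  | iset y _ => y == x
  | seq p q => p.setsIVar x || q.setsIVar x
  | ite _ p q => p.setsIVar x || q.setsIVar x
  | loop _ p => p.setsIVar x
  | _ => false

/-- Whether the program contains an assignment to the real variable `x`. -/
def setsRVar (x : ℕ) : Prog → Bool
  | rset y _ => y == x
  | seq p q => p.setsRVar x || q.setsRVar x
  | ite _ p q => p.setsRVar x || q.setsRVar x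
  | loop _ p => p.setsRVar x
  | _ => false

/-- Whether the program contains an assignment to an entry of the integer array `a`. -/
def setsIArr (a : ℕ) : Prog → Bool
  | iput b _ _ => b == a
  | seq p q => p.setsIArr a || q.setsIArr a
  | ite _ p q => p.setsIArr a || q.setsIArr a
  | loop _ p => p.setsIArr a
  | _ => false

/-- Whether the program contains an assignment to an entry of the real array `a`. -/
def setsRArr (a : ℕ) : Prog → Bool
  | rput b _ _ => b == a
  | seq p q => p.setsRArr a || q.setsRArr a
  | ite _ p q => p.setsRArr a || q.setsRArr a
  | loop _ p => p.setsRArr a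
  | _ => false

end Prog

open Prog

/-- The configurations `s` and `s'` agree on all variables and arrays to which `p` contains no
assignment. -/
structure Frame (p : Prog) (s s' : State) : Prop where
  ivar : ∀ x, p.setsIVar x = false → s'.ivar x = s.ivar x
  rvar : ∀ x, p.setsRVar x = false → s'.rvar x = s.rvar x
  iarr : ∀ a, p.setsIArr a = false → s'.iarr a = s.iarr a
  rarr : ∀ a, p.setsRArr a = false → s'.rarr a = s.rarr a

theorem Frame.refl (p : Prog) (s : State) : Frame p s s :=
  ⟨fun _ _ => rfl, fun _ _ => rfl, fun _ _ => rfl, fun _ _ => rfl⟩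

theorem Frame.trans {p : Prog} {s s' s'' : State} (h : Frame p s s') (h' : Frame p s' s'') :
    Frame p s s'' :=
  ⟨fun x hx => (h'.ivar x hx).trans (h.ivar x hx), fun x hx => (h'.rvar x hx).trans (h.rvar x hx),
    fun x hx => (h'.iarr x hx).trans (h.iarr x hx), fun x hx => (h'.rarr x hx).trans (h.rarr x hx)⟩

theorem Frame.seq_left {p : Prog} {s s' : State} (h : Frame p s s') (q : Prog) :
    Frame (p.seq q) s s' := by
  constructor <;> intro x hx <;> simp only [setsIVar, setsRVar, setsIArr, setsRArr,
    Bool.or_eq_false_iff] at hx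
  exacts [h.ivar x hx.1, h.rvar x hx.1, h.iarr x hx.1, h.rarr x hx.1]

theorem Frame.seq_right {q : Prog} {s s' : State} (h : Frame q s s') (p : Prog) :
    Frame (p.seq q) s s' := by
  constructor <;> intro x hx <;> simp only [setsIVar, setsRVar, setsIArr, setsRArr,
    Bool.or_eq_false_iff] at hx
  exacts [h.ivar x hx.2, h.rvar x hx.2, h.iarr x hx.2, h.rarr x hx.2]

theorem Frame.loop {p : Prog} {s s' : State} (h : Frame p s s') (b : Test) :
    Frame (Prog.loop b p) s s' := ⟨h.ivar, h.rvar, h.iarr, h.rarr⟩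

theorem Exec.frame {p : Prog} {s s' : State} {t : ℕ} (h : Exec p s t s') : Frame p s s' := by
  induction h with
  | skip s => exact Frame.refl _ _
  | iset s x e =>
    refine ⟨fun y hy => ?_, fun _ _ => rfl, fun _ _ => rfl, fun _ _ => rfl⟩
    simp only [setsIVar, beq_eq_false_iff_ne] at hy
    exact Function.update_of_ne hy.symm _ _
  | rset s x e =>
    refine ⟨fun _ _ => rfl, fun y hy => ?_, fun _ _ => rfl, fun _ _ => rfl⟩
    simp only [setsRVar, beq_eq_false_iff_ne] at hy
    exact Function.update_of_ne hy.symm _ _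
  | iput s a i e =>
    refine ⟨fun _ _ => rfl, fun _ _ => rfl, fun y hy => ?_, fun _ _ => rfl⟩
    simp only [setsIArr, beq_eq_false_iff_ne] at hy
    exact Function.update_of_ne hy.symm _ _
  | rput s a i e =>
    refine ⟨fun _ _ => rfl, fun _ _ => rfl, fun _ _ => rfl, fun y hy => ?_⟩
    simp only [setsRArr, beq_eq_false_iff_ne] at hy
    exact Function.update_of_ne hy.symm _ _
  | seq _ _ h₁ h₂ => exact (h₁.seq_left _).trans (h₂.seq_right _)
  | ite_true _ _ h =>
    exact ⟨(h.seq_left _).ivar, (h.seq_left _).rvar, (h.seq_left _).iarr, (h.seq_left _).rarr⟩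
  | ite_false _ _ h =>
    exact ⟨(h.seq_right _).ivar, (h.seq_right _).rvar, (h.seq_right _).iarr, (h.seq_right _).rarr⟩
  | loop_stop _ => exact Frame.refl _ _
  | loop_step _ _ _ h₁ h₂ => exact (h₁.loop _).trans h₂

/-- Started in `s`, the program `p` halts within `p.time L` steps, in a configuration that
satisfies `Q`. -/
def Run (L : ℕ) (p : Prog) (s : State) (Q : State → Prop) : Prop :=
  ∃ t s', t ≤ p.time L ∧ Exec p s t s' ∧ Q s'

namespace Run

variable {L : ℕ} {p q body : Prog} {s : State} {Q Q' : State → Prop}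

/-- The postcondition may be weakened, with the help of the frame condition. -/
theorem imp (h : Run L p s Q) (hQ : ∀ s', Frame p s s' → Q s' → Q' s') : Run L p s Q' := by
  obtain ⟨t, s', ht, he, hq⟩ := h
  exact ⟨t, s', ht, he, hQ s' he.frame hq⟩

theorem skip (h : Q s) : Run L Prog.skip s Q := ⟨1, s, le_rfl, Exec.skip s, h⟩

theorem iset {x : ℕ} {e : IExp}
    (h : Q { s with ivar := Function.update s.ivar x (e.eval s) }) : Run L (Prog.iset x e) s Q :=
  ⟨_, _, le_rfl, Exec.iset s x e, h⟩

theorem rset {x : ℕ} {e : RExp}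
    (h : Q { s with rvar := Function.update s.rvar x (e.eval s) }) : Run L (Prog.rset x e) s Q :=
  ⟨_, _, le_rfl, Exec.rset s x e, h⟩

theorem iput {a : ℕ} {i e : IExp}
    (h : Q { s with
      iarr := Function.update s.iarr a (Function.update (s.iarr a) (i.eval s) (e.eval s)) }) :
    Run L (Prog.iput a i e) s Q :=
  ⟨_, _, le_rfl, Exec.iput s a i e, h⟩

theorem rput {a : ℕ} {i : IExp} {e : RExp}
    (h : Q { s with
      rarr := Function.update s.rarr a (Function.update (s.rarr a) (i.eval s) (e.eval s)) }) :
    Run L (Prog.rput a i e) s Q :=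
  ⟨_, _, le_rfl, Exec.rput s a i e, h⟩

theorem seq (h : Run L p s fun s' => Run L q s' Q) : Run L (p.seq q) s Q := by
  obtain ⟨t, s', ht, he, t', s'', ht', he', hq⟩ := h
  exact ⟨_, _, Nat.add_le_add ht ht', Exec.seq he he', hq⟩

theorem ite {b : Test} (hp : b.Holds s → Run L p s Q) (hq : ¬ b.Holds s → Run L q s Q) :
    Run L (Prog.ite b p q) s Q := by
  by_cases hb : b.Holds s
  · obtain ⟨t, s', ht, he, h⟩ := hp hb
    exact ⟨_, _, by simp only [time]; omega, Exec.ite_true hb he, h⟩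
  · obtain ⟨t, s', ht, he, h⟩ := hq hb
    exact ⟨_, _, by simp only [time]; omega, Exec.ite_false hb he, h⟩

/-- The rule for loops: in `Inv i`, the index `i` bounds the number of iterations to come. -/
theorem loop {b : Test} (Inv : ℕ → State → Prop) {N : ℕ} (hN : N ≤ L) (h0 : Inv N s)
    (hstep : ∀ i s', Inv i s' → b.Holds s' →
      ∃ i', i = i' + 1 ∧ Run L body s' (Inv i')) :
    Run L (Prog.loop b body) s fun s' => ¬ b.Holds s' ∧ ∃ i, Inv i s' := by
  suffices h : ∀ N s, Inv N s → ∃ t s', t ≤ b.cost + N * (b.cost + body.time L) ∧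
      Exec (Prog.loop b body) s t s' ∧ ¬ b.Holds s' ∧ ∃ i, Inv i s' by
    obtain ⟨t, s', ht, h⟩ := h N s h0
    exact ⟨t, s', ht.trans (Nat.add_le_add_left (Nat.mul_le_mul_right _ hN) _), h⟩
  intro M
  induction M with
  | zero =>
    intro s hs
    by_cases hb : b.Holds s
    · obtain ⟨i', hi, _⟩ := hstep _ _ hs hb
      omega
    · exact ⟨_, s, by omega, Exec.loop_stop hb, hb, _, hs⟩
  | succ M ih =>
    intro s hs
    by_cases hb : b.Holds s
    · obtain ⟨i', hi, t, s', ht, he, h⟩ := hstep _ _ hs hb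
      obtain rfl : M = i' := by omega
      obtain ⟨t', s'', ht', he', h'⟩ := ih s' h
      refine ⟨_, s'', ?_, Exec.loop_step hb he he', h'⟩
      rw [Nat.add_mul]
      omega
    · exact ⟨_, s, by omega, Exec.loop_stop hb, hb, _, hs⟩

end Run

/-- The loop `for x = lo, …, y - 1 do body`, where `y` is a variable. -/
def forRange (x : ℕ) (lo : IExp) (y : ℕ) (body : Prog) : Prog :=
  Prog.seq (Prog.iset x lo) (Prog.loop (Test.ilt (IExp.var x) (IExp.var y))
    (Prog.seq body (Prog.iset x (IExp.add (IExp.var x) (IExp.const 1)))))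

theorem Run.forRange {L : ℕ} {x y a N : ℕ} {lo : IExp} {body : Prog} {s : State}
    (Inv : ℕ → State → Prop)
    (hInv : ∀ i s v, Inv i s → Inv i { s with ivar := Function.update s.ivar x v })
    (hN : s.ivar y = N) (hL : N ≤ L) (ha : lo.eval s = a) (haN : a ≤ N) (h0 : Inv a s)
    (hstep : ∀ i, a ≤ i → i < N → ∀ s', Frame (forRange x lo y body) s s' → s'.ivar x = i →
      Inv i s' → Run L body s' (Inv (i + 1)))
    (hx : body.setsIVar x = false := by rfl) (hy : body.setsIVar y = false := by rfl)
    (hxy : y ≠ x := by decide) :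
    Run L (forRange x lo y body) s (Inv N) := by
  refine Run.seq (Run.iset ?_)
  have hf0 : Frame (RealRAM.forRange x lo y body) s
      { s with ivar := Function.update s.ivar x (lo.eval s) } :=
    (Exec.iset s x lo).frame.seq_left _
  have key := Run.loop (L := L) (b := Test.ilt (IExp.var x) (IExp.var y))
    (body := Prog.seq body (Prog.iset x (IExp.add (IExp.var x) (IExp.const 1))))
    (s := { s with ivar := Function.update s.ivar x (lo.eval s) }) (N := N - a)
    (fun j s' => Frame (RealRAM.forRange x lo y body) s s' ∧ s'.ivar x + j = N ∧
      a ≤ s'.ivar x ∧ s'.ivar y = N ∧ Inv (s'.ivar x) s') (by omega) ?_ ?_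
  · refine key.imp fun s' _ ⟨hb, j, _, hj, _, hy', hi⟩ => ?_
    simp only [Test.Holds, IExp.eval, not_lt] at hb
    have : s'.ivar x = N := by omega
    rwa [this] at hi
  · refine ⟨hf0, ?_, ?_, ?_, ?_⟩
    · simp [ha]; omega
    · simp [ha]
    · simp [Function.update_of_ne hxy, hN]
    · simpa [ha] using hInv a s a h0
  · rintro j s' ⟨hf, hj, hax, hy', hi⟩ hb
    simp only [Test.Holds, IExp.eval] at hb
    refine ⟨j - 1, by omega, Run.seq ((hstep _ hax (by omega) s' hf rfl hi).imp ?_)⟩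
    intro s'' hf' hi'
    have e1 := hf'.ivar x hx
    have e2 := hf'.ivar y hy
    have hfs := ((Exec.iset s'' x (IExp.add (IExp.var x) (IExp.const 1))).frame.seq_right body)
    refine Run.iset ⟨hf.trans ?_, ?_, ?_, ?_, ?_⟩
    · exact ((((hf'.seq_left _).trans hfs).loop _).seq_right _)
    · simp [IExp.eval, e1]; omega
    · simp [IExp.eval, e1]; omega
    · simp [Function.update_of_ne hxy, e2, hy']
    · have := hInv _ s'' (s'.ivar x + 1) hi'
      simpa [IExp.eval, e1] using this

end RealRAM

/-! ### Determinants at a local maximum -/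

namespace Subdet

open Matrix

section Blocks

variable {ι κ : Type*} [Fintype ι] [DecidableEq ι] [Fintype κ] [DecidableEq κ]

/-- The Leibniz formula bounds a determinant whose entries are bounded by a matrix of rank one. -/
theorem abs_det_le_of_abs_le_mul (N : Matrix ι ι ℝ) (r c : ι → ℝ)
    (h : ∀ i j, |N i j| ≤ r i * c j) :
    |N.det| ≤ (Fintype.card ι).factorial * ((∏ i, r i) * ∏ i, c i) := by
  rw [det_apply']
  refine (Finset.abs_sum_le_sum_abs _ _).trans ?_
  have : ∀ σ ∈ (Finset.univ : Finset (Equiv.Perm ι)),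
      |((Equiv.Perm.sign σ : ℤ) : ℝ) * ∏ i, N (σ i) i| ≤ (∏ i, r i) * ∏ i, c i := by
    intro σ _
    have hs : |((Equiv.Perm.sign σ : ℤ) : ℝ)| = 1 := by
      rcases Int.units_eq_one_or (Equiv.Perm.sign σ) with h | h <;> simp [h]
    rw [abs_mul, hs, one_mul, Finset.abs_prod, ← Equiv.prod_comp σ r, ← Finset.prod_mul_distrib]
    exact Finset.prod_le_prod (fun _ _ => abs_nonneg _) fun i _ => h _ _
  refine (Finset.sum_le_card_nsmul _ _ _ this).trans ?_
  rw [Finset.card_univ, Fintype.card_perm, nsmul_eq_mul]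

/-- A determinant in terms of the pivot transform at an invertible matrix `P`, both bordered by the
same rows and columns. -/
theorem abs_det_eq_abs_det_mul_abs_det_fromBlocks (P : Matrix ι ι ℝ) (hP : P.det ≠ 0)
    (B : Matrix ι κ ℝ) (C : Matrix κ ι ℝ) (D : Matrix κ κ ℝ) :
    |D.det| = |P.det| * |(fromBlocks (-P⁻¹) (P⁻¹ * B) (C * P⁻¹) (D - C * P⁻¹ * B)).det| := by
  have hu : IsUnit P.det := hP.isUnit
  have hinv : P⁻¹ * P = 1 := nonsing_inv_mul P hu
  let _ : Invertible (-P⁻¹) := ⟨-P, by simp [mul_nonsing_inv P hu], by simp [hinv]⟩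
  have hi : ⅟(-P⁻¹) = -P := rfl
  rw [det_fromBlocks₁₁, hi]
  have : D - C * P⁻¹ * B - C * P⁻¹ * -P * (P⁻¹ * B) = D := by
    have h1 : C * P⁻¹ * -P * (P⁻¹ * B) = -(C * P⁻¹ * B) := by
      rw [Matrix.mul_neg, Matrix.neg_mul, Matrix.mul_assoc C, hinv, Matrix.mul_one,
        Matrix.mul_assoc]
    rw [h1]; abel
  rw [this, abs_mul, det_neg, abs_mul, ← mul_assoc, ← mul_assoc, abs_pow, abs_neg, abs_one,
    one_pow, mul_one, ← abs_mul, ← det_mul, mul_nonsing_inv P hu, det_one, abs_one, one_mul]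

/-- If the entries of the pivot transform satisfy the bounds that local maximality provides, then
scaling its rows and columns turns it into a matrix with bounded entries. -/
theorem abs_det_le_of_pivot_bounds (P : Matrix ι ι ℝ) (hP : P.det ≠ 0)
    (B : Matrix ι κ ℝ) (C : Matrix κ ι ℝ) (D : Matrix κ κ ℝ) {y : ℝ} (hy : 0 < y)
    (hB : ∀ i j, |(P⁻¹ * B) i j| ≤ 2) (hC : ∀ i j, |(C * P⁻¹) i j| ≤ 2)
    (hD : ∀ i j, |(D - C * P⁻¹ * B) i j| ≤ y) (hX : ∀ i j, |P⁻¹ i j| * y ≤ 6) :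
    |D.det| ≤ (Fintype.card ι + Fintype.card κ).factorial *
      ((6 / y) ^ Fintype.card ι * y ^ Fintype.card κ) * |P.det| := by
  rw [abs_det_eq_abs_det_mul_abs_det_fromBlocks P hP B C D, mul_comm]
  refine mul_le_mul_of_nonneg_right ?_ (abs_nonneg _)
  have key := abs_det_le_of_abs_le_mul
    (fromBlocks (-P⁻¹) (P⁻¹ * B) (C * P⁻¹) (D - C * P⁻¹ * B))
    (Sum.elim (fun _ => 1) fun _ => y / 2) (Sum.elim (fun _ => 6 / y) fun _ => 2) ?_
  · refine key.trans (le_of_eq ?_)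
    simp only [Fintype.card_sum, Fintype.prod_sum_type, Sum.elim_inl, Sum.elim_inr,
      Finset.prod_const, Finset.card_univ, one_pow, one_mul]
    have : (y / 2) ^ Fintype.card κ * 2 ^ Fintype.card κ = y ^ Fintype.card κ := by
      rw [← mul_pow]; congr 1; ring
    rw [← this]; ring
  · rintro (i | i) (j | j)
    · simpa [le_div_iff₀ hy] using hX i j
    · simpa using hB i j
    · refine (hC i j).trans ?_
      simp only [Sum.elim_inl, Sum.elim_inr]
      have : y / 2 * (6 / y) = 3 := by field_simp; norm_num
      rw [this]; norm_num
    · simpa using hD i j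

end Blocks

/-- The effect on a determinant of exchanging one row and one column. -/
theorem det_updateRow_updateCol {k : ℕ} (P : Matrix (Fin k) (Fin k) ℝ) (hP : P.det ≠ 0)
    (b c : Fin k → ℝ) (d : ℝ) (i j : Fin k) :
    ((P.updateCol j b).updateRow i (Function.update c j d)).det =
      P.det * ((P⁻¹ *ᵥ b) j * (c ᵥ* P⁻¹) i + P⁻¹ j i * (d - c ᵥ* P⁻¹ ⬝ᵥ b)) := by
  have hu : IsUnit P.det := hP.isUnit
  have hinv : P⁻¹ * P = 1 := nonsing_inv_mul P hu
  set v := c ᵥ* P⁻¹ with hv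
  set Q := P.updateCol j b with hQ
  have hvP : v ᵥ* P = c := by rw [hv, vecMul_vecMul, hinv, vecMul_one]
  have hrow : Function.update c j d = (∑ l, v l • Q l) + (d - v ⬝ᵥ b) • Pi.single j 1 := by
    ext l
    rw [Pi.add_apply, Finset.sum_apply]
    by_cases hl : l = j
    · subst hl
      simp [hQ, dotProduct]
    · rw [Function.update_of_ne hl, ← hvP]
      simp [hQ, hl, vecMul, dotProduct]
  have hdetQ : Q.det = P.det * (P⁻¹ *ᵥ b) j := by
    have := congrFun (det_smul_inv_mulVec_eq_cramer P b hu) j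
    rw [cramer_apply] at this
    rw [hQ, ← this]; rfl
  have hadj : Q.adjugate j i = P.det * P⁻¹ j i := by
    have h1 : Q.adjugate j i = P.adjugate j i := by
      cases k with
      | zero => exact i.elim0
      | succ k =>
        rw [adjugate_fin_succ_eq_det_submatrix, adjugate_fin_succ_eq_det_submatrix]
        congr 2
        ext x z
        simp [hQ, Fin.succAbove_ne]
    rw [h1, inv_def, Ring.inverse_eq_inv', Matrix.smul_apply, smul_eq_mul, mul_inv_cancel_left₀ hP]
  rw [hrow, det_updateRow_add, det_updateRow_smul, det_updateRow_sum, ← adjugate_apply, hadj,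
    hdetQ, smul_eq_mul]
  ring

/-- The `k × k` matrix with the given entries. -/
def mat (k : ℕ) (a : ℕ → ℕ → ℝ) : Matrix (Fin k) (Fin k) ℝ := Matrix.of fun i j => a i j

/-- The absolute value of the determinant of the `k × k` submatrix of the infinite matrix `a` with
row indices `I 0, …, I (k - 1)` and column indices `J 0, …, J (k - 1)`. -/
noncomputable def absDet (k : ℕ) (a : ℕ → ℕ → ℝ) (I J : ℕ → ℕ) : ℝ :=
  |(mat k fun x y => a (I x) (J y)).det|

theorem absDet_nonneg (k : ℕ) (a : ℕ → ℕ → ℝ) (I J : ℕ → ℕ) : 0 ≤ absDet k a I J := abs_nonneg _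

theorem absDet_zero (a : ℕ → ℕ → ℝ) (I J : ℕ → ℕ) : absDet 0 a I J = 1 := by
  simp [absDet]

theorem absDet_congr {k : ℕ} {a b : ℕ → ℕ → ℝ} {I I' J J' : ℕ → ℕ}
    (h : ∀ x < k, ∀ y < k, a (I x) (J y) = b (I' x) (J' y)) :
    absDet k a I J = absDet k b I' J' := by
  unfold absDet
  congr 2
  ext x y
  exact h x x.2 y y.2

theorem absDet_congr_slots {k : ℕ} {a : ℕ → ℕ → ℝ} {I I' J J' : ℕ → ℕ}
    (hI : ∀ x < k, I x = I' x) (hJ : ∀ x < k, J x = J' x) :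
    absDet k a I J = absDet k a I' J' :=
  absDet_congr fun x hx y hy => by rw [hI x hx, hJ y hy]

/-- A step of Laplace expansion: if all `k × k` determinants vanish, so do the larger ones. -/
theorem absDet_succ_eq_zero {m n k : ℕ} {a : ℕ → ℕ → ℝ}
    (h : ∀ I J : ℕ → ℕ, (∀ x < k, I x < m ∧ J x < n) → absDet k a I J = 0) (I J : ℕ → ℕ)
    (hIJ : ∀ x < k + 1, I x < m ∧ J x < n) : absDet (k + 1) a I J = 0 := by
  rw [absDet, abs_eq_zero, det_succ_row_zero]
  refine Finset.sum_eq_zero fun j _ => ?_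
  have := h (fun x => I (x + 1)) (fun y => if h : y < k then J (j.succAbove ⟨y, h⟩) else 0)
    fun x hx => ⟨(hIJ (x + 1) (by omega)).1, by
      simp only [hx, dif_pos]; exact (hIJ _ (Fin.is_lt _)).2⟩
  rw [absDet, abs_eq_zero] at this
  rw [mul_eq_zero]
  right
  rw [← this]
  congr 1
  ext x y
  simp [mat]

/-- Local maximality with respect to the exchanges of one row and one column. -/
def ExchangeMax (m n k : ℕ) (a : ℕ → ℕ → ℝ) (I J : ℕ → ℕ) : Prop :=
  ∀ p < k, ∀ q < k, ∀ v < m, ∀ w < n,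
    absDet k a (Function.update I p v) (Function.update J q w) ≤ 2 * absDet k a I J

section Pivot

variable {m n k : ℕ} {a : ℕ → ℕ → ℝ} {I J : ℕ → ℕ}

/-- The entry `(v, w)` of the Schur complement of the submatrix with rows `I` and columns `J`. -/
noncomputable def schur (k : ℕ) (a : ℕ → ℕ → ℝ) (I J : ℕ → ℕ) (v w : ℕ) : ℝ :=
  a v w - (fun y : Fin k => a v (J y)) ᵥ* (mat k fun x y => a (I x) (J y))⁻¹ ⬝ᵥ
    fun x : Fin k => a (I x) w

theorem absDet_update_update (hP : (mat k fun x y => a (I x) (J y)).det ≠ 0) (p q : Fin k)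
    (v w : ℕ) :
    absDet k a (Function.update I p v) (Function.update J q w) =
      absDet k a I J *
        |((mat k fun x y => a (I x) (J y))⁻¹ *ᵥ fun x : Fin k => a (I x) w) q *
            ((fun y : Fin k => a v (J y)) ᵥ* (mat k fun x y => a (I x) (J y))⁻¹) p +
          (mat k fun x y => a (I x) (J y))⁻¹ q p * schur k a I J v w| := by
  rw [schur, absDet, absDet, ← abs_mul, ← det_updateRow_updateCol _ hP]
  congr 2
  ext x y
  by_cases hx : x = p <;> by_cases hy : y = q <;>
    simp [mat, hx, hy, Function.update_apply, updateRow_apply, Fin.val_inj]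

/-- Bordering by one row and one column multiplies the determinant by an entry of the Schur
complement. -/
theorem absDet_succ (hP : (mat k fun x y => a (I x) (J y)).det ≠ 0) :
    absDet (k + 1) a I J = absDet k a I J * |schur k a I J (I k) (J k)| := by
  set P := mat k fun x y => a (I x) (J y) with hPdef
  have hu : IsUnit P.det := hP.isUnit
  let _ : Invertible P := P.invertibleOfIsUnitDet hu
  have h := det_submatrix_equiv_self (finSumFinEquiv (m := k) (n := 1))
    (mat (k + 1) fun x y => a (I x) (J y))
  have h2 : (mat (k + 1) fun x y => a (I x) (J y)).submatrix (finSumFinEquiv (m := k) (n := 1))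
      finSumFinEquiv = fromBlocks P (Matrix.of fun x _ => a (I x) (J k))
        (Matrix.of fun _ y => a (I k) (J y)) (Matrix.of fun _ _ => a (I k) (J k)) := by
    ext (x | x) (y | y) <;> simp [mat, hPdef]
  rw [absDet, ← h, h2, det_fromBlocks₁₁, abs_mul, absDet, det_unique (n := Fin 1), invOf_eq_nonsing_inv]
  rfl

variable (hP : (mat k fun x y => a (I x) (J y)).det ≠ 0)
  (hIJ : ∀ x < k, I x < m ∧ J x < n) (hmax : ExchangeMax m n k a I J)
include hP hIJ hmax

omit hIJ in
theorem abs_exchange_le_two (p q : Fin k) {v w : ℕ} (hv : v < m) (hw : w < n) :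
    |((mat k fun x y => a (I x) (J y))⁻¹ *ᵥ fun x : Fin k => a (I x) w) q *
        ((fun y : Fin k => a v (J y)) ᵥ* (mat k fun x y => a (I x) (J y))⁻¹) p +
      (mat k fun x y => a (I x) (J y))⁻¹ q p * schur k a I J v w| ≤ 2 := by
  have h := hmax p p.2 q q.2 v hv w hw
  rw [absDet_update_update hP, mul_comm 2] at h
  exact le_of_mul_le_mul_left h (abs_pos.2 hP)

theorem abs_mulVec_le_two (q : Fin k) {w : ℕ} (hw : w < n) :
    |((mat k fun x y => a (I x) (J y))⁻¹ *ᵥ fun x : Fin k => a (I x) w) q| ≤ 2 := by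
  -- the row `I q` is exchanged for itself
  have h := hmax q q.2 q q.2 (I q) (hIJ q q.2).1 w hw
  set P := mat k fun x y => a (I x) (J y) with hPdef
  have hu : IsUnit P.det := hP.isUnit
  have hdet : absDet k a (Function.update I q (I q)) (Function.update J q w) =
      absDet k a I J * |(P⁻¹ *ᵥ fun x : Fin k => a (I x) w) q| := by
    have h2 := congrFun (det_smul_inv_mulVec_eq_cramer P (fun x : Fin k => a (I x) w) hu) q
    rw [cramer_apply] at h2
    rw [absDet, absDet, ← abs_mul, ← smul_eq_mul, ← hPdef]
    change _ = |(P.det • (P⁻¹ *ᵥ fun x : Fin k => a (I x) w)) q|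
    rw [h2, Function.update_eq_self]
    congr 2
    ext x y
    by_cases hy : y = q <;> simp [mat, hPdef, hy, Function.update_apply, Fin.val_inj]
  rw [hdet, mul_comm 2] at h
  exact le_of_mul_le_mul_left h (abs_pos.2 hP)

theorem abs_vecMul_le_two (p : Fin k) {v : ℕ} (hv : v < m) :
    |((fun y : Fin k => a v (J y)) ᵥ* (mat k fun x y => a (I x) (J y))⁻¹) p| ≤ 2 := by
  have hT : (mat k fun x y => a (I y) (J x)) = (mat k fun x y => a (I x) (J y))ᵀ := rfl
  have htr : ∀ I J, absDet k (fun x y => a y x) J I = absDet k a I J := by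
    intro I J
    rw [absDet, absDet, ← det_transpose]; rfl
  have h := abs_mulVec_le_two (m := n) (n := m) (k := k) (a := fun x y => a y x) (I := J) (J := I)
    (by rw [hT, det_transpose]; exact hP) (fun x hx => (hIJ x hx).symm)
    (fun p hp q hq v hv w hw => by rw [htr, htr]; exact hmax q hq p hp w hw v hv) p hv
  rwa [hT, ← transpose_nonsing_inv, mulVec_transpose] at h

theorem abs_inv_mul_abs_schur_le (p q : Fin k) {v w : ℕ} (hv : v < m) (hw : w < n) :
    |(mat k fun x y => a (I x) (J y))⁻¹ q p| * |schur k a I J v w| ≤ 6 := by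
  have h1 := abs_exchange_le_two hP hmax p q hv hw
  have h2 := abs_mulVec_le_two hP hIJ hmax q hw
  have h3 := abs_vecMul_le_two hP hIJ hmax p hv
  have h4 := mul_le_mul h2 h3 (abs_nonneg _) zero_le_two
  rw [← abs_mul] at h4 ⊢
  rw [abs_le] at *
  constructor <;> linarith [h1.1, h1.2, h4.1, h4.2]

/-- The comparison of a local maximum with another submatrix, of any size, in terms of a bound `y`
for the entries of the Schur complement. -/
theorem absDet_le_of_schur_le {k' : ℕ} {I' J' : ℕ → ℕ} (hIJ' : ∀ x < k', I' x < m ∧ J' x < n)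
    {y : ℝ} (hy : 0 < y) (hS : ∀ v < m, ∀ w < n, |schur k a I J v w| ≤ y)
    (hX : ∀ p q, |(mat k fun x y => a (I x) (J y))⁻¹ q p| * y ≤ 6) :
    absDet k' a I' J' ≤ (k + k').factorial * ((6 / y) ^ k * y ^ k') * absDet k a I J := by
  have := abs_det_le_of_pivot_bounds (mat k fun x y => a (I x) (J y)) hP
    (Matrix.of fun (x : Fin k) (y : Fin k') => a (I x) (J' y))
    (Matrix.of fun (x : Fin k') (y : Fin k) => a (I' x) (J y))
    (mat k' fun x y => a (I' x) (J' y)) hy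
    (fun i j => abs_mulVec_le_two hP hIJ hmax i (hIJ' j j.2).2)
    (fun i j => abs_vecMul_le_two hP hIJ hmax j (hIJ' i i.2).1)
    (fun i j => hS _ (hIJ' i i.2).1 _ (hIJ' j j.2).2) (fun i j => hX j i)
  rwa [Fintype.card_fin, Fintype.card_fin] at this

omit hP hIJ hmax in
theorem exists_abs_inv_mul_le (P : Matrix (Fin k) (Fin k) ℝ) :
    ∃ y₀ : ℝ, 0 < y₀ ∧ ∀ y, 0 ≤ y → y ≤ y₀ → ∀ p q, |P q p| * y ≤ 6 := by
  have hs : 0 ≤ ∑ i, ∑ j, |P i j| :=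
    Finset.sum_nonneg fun _ _ => Finset.sum_nonneg fun _ _ => abs_nonneg _
  refine ⟨6 / (1 + ∑ i, ∑ j, |P i j|), by positivity, fun y hy hy' p q => ?_⟩
  have h1 : |P q p| ≤ ∑ i, ∑ j, |P i j| :=
    (Finset.single_le_sum (f := fun j => |P q j|) (fun _ _ => abs_nonneg _)
      (Finset.mem_univ p)).trans
      (Finset.single_le_sum (f := fun i => ∑ j, |P i j|)
        (fun _ _ => Finset.sum_nonneg fun _ _ => abs_nonneg _) (Finset.mem_univ q))
  rw [le_div_iff₀ (by positivity)] at hy'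
  nlinarith

/-- A local maximum is an approximate maximum. -/
theorem absDet_le_of_exchangeMax {I' J' : ℕ → ℕ} (hIJ' : ∀ x < k, I' x < m ∧ J' x < n) :
    absDet k a I' J' ≤ (2 * k).factorial * 6 ^ k * absDet k a I J := by
  obtain ⟨y, hy, hS, hX⟩ : ∃ y : ℝ, 0 < y ∧ (∀ v < m, ∀ w < n, |schur k a I J v w| ≤ y) ∧
      ∀ p q, |(mat k fun x y => a (I x) (J y))⁻¹ q p| * y ≤ 6 := by
    by_cases h : ∀ v < m, ∀ w < n, schur k a I J v w = 0
    · obtain ⟨y, hy, hX⟩ := exists_abs_inv_mul_le (mat k fun x y => a (I x) (J y))⁻¹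
      exact ⟨y, hy, fun v hv w hw => by rw [h v hv w hw, abs_zero]; exact hy.le,
        hX y hy.le le_rfl⟩
    · push Not at h
      obtain ⟨v, hv, w, hw, h0⟩ := h
      obtain ⟨z, hz, hmaxz⟩ := Finset.exists_max_image (Finset.range m ×ˢ Finset.range n)
        (fun z => |schur k a I J z.1 z.2|) ⟨(v, w), by simp [hv, hw]⟩
      simp only [Finset.mem_product, Finset.mem_range, Prod.forall, and_imp] at hz hmaxz
      exact ⟨_, (abs_pos.2 h0).trans_le (hmaxz v w hv hw), fun v hv w hw => hmaxz v w hv hw,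
        fun p q => abs_inv_mul_abs_schur_le hP hIJ hmax p q hz.1 hz.2⟩
  refine (absDet_le_of_schur_le hP hIJ hmax hIJ' hy hS hX).trans (le_of_eq ?_)
  rw [← mul_pow, div_mul_cancel₀ _ hy.ne', two_mul]

/-- If a local maximum is extended by the best pair of a row and a column, then the result is an
approximate maximum. -/
theorem absDet_succ_le_of_exchangeMax {I' J' : ℕ → ℕ} (hIJ' : ∀ x < k + 1, I' x < m ∧ J' x < n)
    (hk : I k < m ∧ J k < n)
    (hext : ∀ v < m, ∀ w < n,
      absDet (k + 1) a (Function.update I k v) (Function.update J k w) ≤ absDet (k + 1) a I J) :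
    absDet (k + 1) a I' J' ≤ (2 * k + 1).factorial * 6 ^ k * absDet (k + 1) a I J := by
  have hcongr : ∀ v w : ℕ, mat k (fun x y => a (Function.update I k v x)
      (Function.update J k w y)) = mat k fun x y => a (I x) (J y) := by
    intro v w
    ext x y
    simp [mat, Function.update_of_ne x.2.ne, Function.update_of_ne y.2.ne]
  have hS : ∀ v < m, ∀ w < n, |schur k a I J v w| ≤ |schur k a I J (I k) (J k)| := by
    intro v hv w hw
    have h := hext v hv w hw
    rw [absDet_succ hP, absDet_succ (by rw [hcongr]; exact hP), absDet, hcongr] at h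
    have h1 := le_of_mul_le_mul_left h (abs_pos.2 hP)
    have h2 : schur k a (Function.update I k v) (Function.update J k w)
        (Function.update I k v k) (Function.update J k w k) = schur k a I J v w := by
      unfold schur
      rw [hcongr]
      simp [Function.update_of_ne (Fin.is_lt _).ne]
    rwa [h2] at h1
  have hb : ∀ y : ℝ, 0 < y → |schur k a I J (I k) (J k)| ≤ y →
      (∀ p q, |(mat k fun x y => a (I x) (J y))⁻¹ q p| * y ≤ 6) →
      absDet (k + 1) a I' J' ≤ (2 * k + 1).factorial * 6 ^ k * absDet k a I J * y := by
    intro y hy hSy hX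
    refine (absDet_le_of_schur_le hP hIJ hmax hIJ' hy
      (fun v hv w hw => (hS v hv w hw).trans hSy) hX).trans (le_of_eq ?_)
    rw [pow_succ, ← mul_assoc ((6 / y) ^ k), ← mul_pow, div_mul_cancel₀ _ hy.ne', two_mul,
      add_assoc]
    ring
  rw [absDet_succ hP]
  rcases (abs_nonneg (schur k a I J (I k) (J k))).eq_or_lt with h0 | h0
  · -- all entries of the Schur complement vanish, and every small `y` bounds them
    obtain ⟨y₀, hy₀, hX⟩ := exists_abs_inv_mul_le (mat k fun x y => a (I x) (J y))⁻¹
    rw [← h0, mul_zero, mul_zero]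
    have hlim : Filter.Tendsto
        (fun y : ℝ => (2 * k + 1).factorial * 6 ^ k * absDet k a I J * y)
        (nhdsWithin 0 (Set.Ioi 0)) (nhds ((2 * k + 1).factorial * 6 ^ k * absDet k a I J * 0)) :=
      ((continuous_const.mul continuous_id).tendsto _).mono_left nhdsWithin_le_nhds
    rw [mul_zero] at hlim
    refine ge_of_tendsto hlim ?_
    filter_upwards [Ioc_mem_nhdsGT hy₀] with y hy
    exact hb y hy.1 (h0 ▸ hy.1.le) (hX y hy.1.le hy.2)
  · refine (hb _ h0 le_rfl fun p q =>
      abs_inv_mul_abs_schur_le hP hIJ hmax p q hk.1 hk.2).trans (le_of_eq ?_)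
    ring

end Pivot

end Subdet

/-! ### A program for determinants -/

namespace Subdet

open RealRAM Matrix

/-- The address of the entry `(x, y)` of a matrix stored with stride `n`, where `x` and `y` are
integer variables; the integer array `2` lists the multiples of `n`. -/
def cell (x y : ℕ) : IExp := IExp.add (IExp.arr 2 (IExp.var x)) (IExp.var y)

/-- The entry `(x, y)` of the working matrix. -/
def work (x y : ℕ) : RExp := RExp.arr 1 (cell x y)

/-- Copies the `k × k` submatrix whose rows and columns are listed in the integer arrays `3` and `4`
into the working matrix. -/
def fillWork : Prog :=
  forRange 11 (IExp.const 0) 3 (forRange 12 (IExp.const 0) 3 (Prog.rput 1 (cell 11 12)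
    (RExp.arr 0 (IExp.add (IExp.arr 2 (IExp.arr 3 (IExp.var 11))) (IExp.arr 4 (IExp.var 12))))))

/-- Adds to row `x` of the working matrix the multiple of row `y` by the real variable `2`. -/
def addRow (x y : ℕ) : Prog :=
  forRange 12 (IExp.const 0) 3 (Prog.rput 1 (cell x 12)
    (RExp.add (work x 12) (RExp.mul (RExp.var 2) (work y 12))))

/-- Clears the entry in row `11` and column `10`.  If the pivot is zero, the row is added to the pivot
row beforehand; this takes the place of a search for a pivot. -/
def clearEntry : Prog :=
  Prog.seq
    (Prog.ite (Test.and (Test.not (Test.rlt (work 10 10) RExp.zero))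
        (Test.not (Test.rlt RExp.zero (work 10 10))))
      (Prog.seq (Prog.rset 2 RExp.one) (addRow 10 11)) Prog.skip)
    (Prog.seq (Prog.rset 2 (RExp.sub RExp.zero (RExp.div (work 11 10) (work 10 10))))
      (addRow 11 10))

/-- Gaussian elimination on the working matrix. -/
def eliminate : Prog :=
  forRange 10 (IExp.const 0) 3 (forRange 11 (IExp.add (IExp.var 10) (IExp.const 1)) 3 clearEntry)

/-- The absolute value of the product of the diagonal entries of the working matrix. -/
def diagProduct : Prog :=
  Prog.seq (Prog.rset 0 RExp.one)
    (Prog.seq (forRange 10 (IExp.const 0) 3 (Prog.rset 0 (RExp.mul (RExp.var 0) (work 10 10))))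
      (Prog.ite (Test.rlt (RExp.var 0) RExp.zero)
        (Prog.rset 0 (RExp.sub RExp.zero (RExp.var 0))) Prog.skip))

/-- Stores the absolute value of the determinant of the submatrix listed in the integer arrays `3`
and `4` in the real variable `0`. -/
def computeAbsDet : Prog := Prog.seq fillWork (Prog.seq eliminate diagProduct)

/-- The part of a configuration that stays fixed while the submatrices of size `k` are explored:
the input, the size `k` in variable `3`, the bounds of the loops over moves in variables `4` and `5`,
and the table of multiples of `n`. -/
structure Ctx (m n k : ℕ) (α : ℕ → ℝ) (s : State) : Prop where
  rows : s.ivar 0 = m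
  cols : s.ivar 1 = n
  size : s.ivar 3 = k
  sum : s.ivar 4 = m + n
  two : s.ivar 5 = 2
  base : ∀ i < m, s.iarr 2 i = n * i
  entries : s.rarr 0 = α
  size_le_rows : k ≤ m
  size_le_cols : k ≤ n

section

variable {m n k L : ℕ} {α : ℕ → ℝ} {s s' : State}

theorem Ctx.frame {p : Prog} (h : Ctx m n k α s) (hf : Frame p s s')
    (h0 : p.setsIVar 0 = false := by rfl) (h1 : p.setsIVar 1 = false := by rfl)
    (h3 : p.setsIVar 3 = false := by rfl) (h4 : p.setsIVar 4 = false := by rfl)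
    (h5 : p.setsIVar 5 = false := by rfl) (h2 : p.setsIArr 2 = false := by rfl)
    (hr : p.setsRArr 0 = false := by rfl) : Ctx m n k α s' where
  rows := (hf.ivar 0 h0).trans h.rows
  cols := (hf.ivar 1 h1).trans h.cols
  size := (hf.ivar 3 h3).trans h.size
  sum := (hf.ivar 4 h4).trans h.sum
  two := (hf.ivar 5 h5).trans h.two
  base := by rw [hf.iarr 2 h2]; exact h.base
  entries := (hf.rarr 0 hr).trans h.entries
  size_le_rows := h.size_le_rows
  size_le_cols := h.size_le_cols

/-- The working matrix. -/
def ent (n : ℕ) (s : State) (i j : ℕ) : ℝ := s.rarr 1 (n * i + j)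

theorem mul_add_inj {n i j i' j' : ℕ} (hj : j < n) (hj' : j' < n) :
    n * i + j = n * i' + j' ↔ i = i' ∧ j = j' := by
  refine ⟨fun h => ?_, fun h => by rw [h.1, h.2]⟩
  have h1 := congrArg (· / n) h
  have hn : 0 < n := by omega
  simp only [Nat.mul_add_div hn, Nat.div_eq_of_lt hj, Nat.div_eq_of_lt hj', add_zero] at h1
  subst h1
  exact ⟨rfl, by omega⟩

theorem ent_store {p q i j : ℕ} (v : ℝ) (hq : q < n) (hj : j < n) :
    ent n { s with
      rarr := Function.update s.rarr 1 (Function.update (s.rarr 1) (n * p + q) v) } i j =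
      if i = p ∧ j = q then v else ent n s i j := by
  simp only [ent, Function.update_self, Function.update_apply, mul_add_inj hj hq]

theorem Ctx.eval_cell (h : Ctx m n k α s) {x y p q : ℕ} (hx : s.ivar x = p) (hp : p < m)
    (hy : s.ivar y = q) : (cell x y).eval s = n * p + q := by
  simp only [cell, IExp.eval, hx, hy, h.base p hp]

theorem Ctx.eval_work (h : Ctx m n k α s) {x y p q : ℕ} (hx : s.ivar x = p) (hp : p < m)
    (hy : s.ivar y = q) : (work x y).eval s = ent n s p q := by
  simp only [work, RExp.eval, h.eval_cell hx hp hy, ent]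

theorem run_fillWork (h : Ctx m n k α s) (hL : m ≤ L)
    (hI : ∀ x < k, s.iarr 3 x < m ∧ s.iarr 4 x < n) :
    Run L fillWork s fun s' => ∀ i < k, ∀ j < k,
      ent n s' i j = α (n * s.iarr 3 i + s.iarr 4 j) := by
  have hkL := h.size_le_rows.trans hL
  refine Run.forRange (fun r s' => ∀ i < r, ∀ j < k,
    ent n s' i j = α (n * s.iarr 3 i + s.iarr 4 j)) (fun _ _ _ hi => hi) h.size hkL (a := 0) rfl
    (Nat.zero_le _) (fun i hi => by omega) ?_
  intro r _ hr s₁ hf₁ hx₁ hi₁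
  have h₁ := h.frame hf₁
  refine (Run.forRange (fun c s' => (∀ i < r, ∀ j < k,
    ent n s' i j = α (n * s.iarr 3 i + s.iarr 4 j)) ∧ ∀ j < c,
    ent n s' r j = α (n * s.iarr 3 r + s.iarr 4 j)) (fun _ _ _ hi => hi) h₁.size hkL (a := 0) rfl
    (Nat.zero_le _) ⟨hi₁, fun i hi => by omega⟩ ?_).imp ?_
  · intro c _ hc s₂ hf₂ hx₂ hi₂
    have h₂ := h₁.frame hf₂
    have hx₂' : s₂.ivar 11 = r := (hf₂.ivar 11 rfl).trans hx₁
    have hcn := hc.trans_le h.size_le_cols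
    refine Run.rput ?_
    rw [h₂.eval_cell hx₂' (hr.trans_le h.size_le_rows) hx₂]
    have hval : (RExp.arr 0 (IExp.add (IExp.arr 2 (IExp.arr 3 (IExp.var 11)))
        (IExp.arr 4 (IExp.var 12)))).eval s₂ = α (n * s.iarr 3 r + s.iarr 4 c) := by
      have e3 : s₂.iarr 3 = s.iarr 3 := (hf₂.iarr 3 rfl).trans (hf₁.iarr 3 rfl)
      have e4 : s₂.iarr 4 = s.iarr 4 := (hf₂.iarr 4 rfl).trans (hf₁.iarr 4 rfl)
      simp only [RExp.eval, IExp.eval, hx₂, hx₂', e3, e4, h₂.base _ (hI r hr).1, h₂.entries]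
    rw [hval]
    refine ⟨fun i hi j hj => ?_, fun j hj => ?_⟩
    · rw [ent_store _ hcn (hj.trans_le h.size_le_cols), if_neg (by omega), hi₂.1 i hi j hj]
    · rw [ent_store _ hcn (by omega)]
      split_ifs with hjc
      · rw [hjc.2]
      · exact hi₂.2 j (by omega)
  · rintro s₂ _ ⟨hi, hi'⟩ i hir j hj
    rcases Nat.lt_succ_iff_lt_or_eq.1 hir with hlt | rfl
    exacts [hi i hlt j hj, hi' j hj]

/-- The matrix that results from `b` by adding `f` times row `q` to row `p`. -/
def rowAdd (b : ℕ → ℕ → ℝ) (p q : ℕ) (f : ℝ) (i j : ℕ) : ℝ :=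
  if i = p then b p j + f * b q j else b i j

theorem det_rowAdd (b : ℕ → ℕ → ℝ) {p q : ℕ} (hp : p < k) (hq : q < k) (hpq : p ≠ q) (f : ℝ) :
    (mat k (rowAdd b p q f)).det = (mat k b).det := by
  have := det_updateRow_add_smul_self (mat k b) (i := ⟨p, hp⟩) (j := ⟨q, hq⟩)
    (by simpa using hpq) f
  rw [← this]
  congr 1
  ext i j
  by_cases hi : i = ⟨p, hp⟩
  · subst hi; simp [mat, rowAdd]
  · have : (i : ℕ) ≠ p := fun h => hi (Fin.ext h)
    simp [mat, rowAdd, hi, this]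

theorem mat_congr {b b' : ℕ → ℕ → ℝ} (h : ∀ i < k, ∀ j < k, b i j = b' i j) :
    mat k b = mat k b' := by
  ext i j; exact h i i.2 j j.2

theorem run_addRow (h : Ctx m n k α s) (hL : m ≤ L) {x y p q : ℕ} (hx : s.ivar x = p)
    (hy : s.ivar y = q) (hp : p < k) (hq : q < k) (hx12 : x ≠ 12) (hy12 : y ≠ 12) :
    Run L (addRow x y) s fun s' => ∀ i < k, ∀ j < k,
      ent n s' i j = rowAdd (ent n s) p q (s.rvar 2) i j := by
  refine (Run.forRange (fun c s' => ∀ i < k, ∀ j < k, ent n s' i j =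
    if j < c then rowAdd (ent n s) p q (s.rvar 2) i j else ent n s i j) (fun _ _ _ hi => hi)
    h.size (h.size_le_rows.trans hL) (a := 0) rfl (Nat.zero_le _) (fun i _ j _ => by simp) ?_).imp ?_
  · intro c _ hc s₁ hf hc₁ hi
    have h₁ := h.frame hf
    have hset : ∀ z, z ≠ 12 → (RealRAM.forRange 12 (IExp.const 0) 3 (Prog.rput 1 (cell x 12)
      (RExp.add (work x 12) (RExp.mul (RExp.var 2) (work y 12))))).setsIVar z = false := by
      intro z hz
      simp [RealRAM.forRange, Prog.setsIVar, hz.symm]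
    have hx₁ := (hf.ivar x (hset x hx12)).trans hx
    have hy₁ := (hf.ivar y (hset y hy12)).trans hy
    have hpm := hp.trans_le h.size_le_rows
    have hqm := hq.trans_le h.size_le_rows
    refine Run.rput fun i hi' j hj => ?_
    simp only [RExp.eval, h₁.eval_cell hx₁ hpm hc₁, h₁.eval_work hx₁ hpm hc₁,
      h₁.eval_work hy₁ hqm hc₁, hf.rvar 2 rfl]
    rw [ent_store _ (hc.trans_le h.size_le_cols) (hj.trans_le h.size_le_cols), hi i hi' j hj,
      hi p hp c hc, hi q hq c hc, if_neg (lt_irrefl c), if_neg (lt_irrefl c)]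
    rcases lt_trichotomy j c with hjc | rfl | hjc
    · rw [if_neg (by omega), if_pos hjc, if_pos (by omega)]
    · rw [if_neg (lt_irrefl j), if_pos (Nat.lt_succ_self j)]
      by_cases hip : i = p
      · rw [if_pos ⟨hip, rfl⟩, rowAdd, if_pos hip]
      · rw [if_neg (fun h => hip h.1), rowAdd, if_neg hip]
    · rw [if_neg (by omega), if_neg (by omega), if_neg (by omega)]
  · intro s' _ hi i hi' j hj
    rw [hi i hi' j hj, if_pos hj]

/-- The state of the elimination: the columns before `t` are cleared below the diagonal, and column
`t` is cleared in the rows strictly between `t` and `r`. -/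
def Cleared (k t r : ℕ) (b : ℕ → ℕ → ℝ) : Prop :=
  (∀ c < t, ∀ i < k, c < i → b i c = 0) ∧ ∀ i, t < i → i < r → b i t = 0

theorem Cleared.rowAdd {b : ℕ → ℕ → ℝ} {t r p q : ℕ} {f : ℝ} (h : Cleared k t r b)
    (hpk : p < k) (hqk : q < k) (hp : p = t ∨ p = r) (hq : t ≤ q) :
    Cleared k t r (rowAdd b p q f) := by
  refine ⟨fun c hc i hi hci => ?_, fun i hti hir => ?_⟩
  · rw [Subdet.rowAdd]
    split_ifs
    · rw [h.1 c hc p hpk (by omega), h.1 c hc q hqk (by omega)]; ring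
    · exact h.1 c hc i hi hci
  · rw [Subdet.rowAdd, if_neg (by omega)]
    exact h.2 i hti hir

theorem Cleared.congr {b b' : ℕ → ℕ → ℝ} {t r : ℕ} (h : Cleared k t r b) (ht : t < k) (hr : r ≤ k)
    (hb : ∀ i < k, ∀ j < k, b' i j = b i j) : Cleared k t r b' :=
  ⟨fun c hc i hi hci => by rw [hb i hi c (by omega)]; exact h.1 c hc i hi hci,
    fun i hti hir => by rw [hb i (by omega) t ht]; exact h.2 i hti hir⟩

theorem run_clearEntry (h : Ctx m n k α s) (hL : m ≤ L) {t r : ℕ} (ht : s.ivar 10 = t)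
    (hr : s.ivar 11 = r) (htr : t < r) (hrk : r < k) (hc : Cleared k t r (ent n s)) :
    Run L clearEntry s fun s' => Cleared k t (r + 1) (ent n s') ∧
      (mat k (ent n s')).det = (mat k (ent n s)).det := by
  have htk := htr.trans hrk
  have hrm := hrk.trans_le h.size_le_rows
  have htm := htk.trans_le h.size_le_rows
  have first : Run L (Prog.ite (Test.and (Test.not (Test.rlt (work 10 10) RExp.zero))
        (Test.not (Test.rlt RExp.zero (work 10 10))))
      (Prog.seq (Prog.rset 2 RExp.one) (addRow 10 11)) Prog.skip) s fun s' =>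
      Cleared k t r (ent n s') ∧ (mat k (ent n s')).det = (mat k (ent n s)).det ∧
      (ent n s' t t = 0 → ent n s' r t = 0) := by
    refine Run.ite (fun hb => ?_) (fun hb => ?_)
    · have h0 : ent n s t t = 0 := by
        simp only [Test.Holds, RExp.eval, h.eval_work ht htm ht, not_lt] at hb
        exact le_antisymm hb.2 hb.1
      refine Run.seq (Run.rset ?_)
      refine (run_addRow (s := { s with rvar := Function.update s.rvar 2 (RExp.one.eval s) })
        ⟨h.rows, h.cols, h.size, h.sum, h.two, h.base, h.entries, h.size_le_rows,
          h.size_le_cols⟩ hL ht hr htk hrk (by decide) (by decide)).imp fun s' _ hs' => ?_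
      have hs'' : ∀ i < k, ∀ j < k, ent n s' i j = rowAdd (ent n s) t r 1 i j := by
        intro i hi j hj
        rw [hs' i hi j hj]
        simp only [Function.update_self, RExp.eval]
        rfl
      refine ⟨(hc.rowAdd htk hrk (Or.inl rfl) htr.le).congr htk hrk.le hs'', ?_, ?_⟩
      · rw [mat_congr hs'', det_rowAdd _ htk hrk htr.ne]
      · rw [hs'' t htk t htk, hs'' r hrk t htk, rowAdd, rowAdd, if_pos rfl, if_neg htr.ne', h0]
        intro h
        linarith
    · refine Run.skip ⟨hc, rfl, fun h0 => ?_⟩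
      simp only [Test.Holds, RExp.eval, h.eval_work ht htm ht, h0, lt_irrefl] at hb
      simp at hb
  refine Run.seq (first.imp ?_)
  rintro s₁ hf ⟨hc₁, hdet, hz⟩
  have h₁ := h.frame hf
  have ht₁ := (hf.ivar 10 rfl).trans ht
  have hr₁ := (hf.ivar 11 rfl).trans hr
  refine Run.seq (Run.rset ?_)
  simp only [RExp.eval, h₁.eval_work ht₁ htm ht₁, h₁.eval_work hr₁ hrm ht₁]
  refine (run_addRow (s := { s₁ with rvar := Function.update s₁.rvar 2 _ })
    ⟨h₁.rows, h₁.cols, h₁.size, h₁.sum, h₁.two, h₁.base, h₁.entries, h₁.size_le_rows,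
      h₁.size_le_cols⟩ hL hr₁ ht₁ hrk htk (by decide) (by decide)).imp fun s' _ hs' => ?_
  have hs'' : ∀ i < k, ∀ j < k, ent n s' i j =
      rowAdd (ent n s₁) r t (0 - ent n s₁ r t / ent n s₁ t t) i j := by
    intro i hi j hj
    rw [hs' i hi j hj]
    simp only [Function.update_self]
    rfl
  have hc₂ := (hc₁.rowAdd (f := 0 - ent n s₁ r t / ent n s₁ t t) hrk htk (Or.inr rfl)
    le_rfl).congr htk hrk.le hs''
  refine ⟨⟨hc₂.1, fun i hti hir => ?_⟩, ?_⟩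
  · rcases Nat.lt_succ_iff_lt_or_eq.1 hir with hlt | rfl
    · exact hc₂.2 i hti hlt
    · rw [hs'' i hrk t htk, rowAdd, if_pos rfl]
      by_cases h0 : ent n s₁ t t = 0
      · rw [hz h0, h0]; ring
      · field_simp; ring
  · rw [mat_congr hs'', det_rowAdd _ hrk htk htr.ne', hdet]

theorem run_eliminate (h : Ctx m n k α s) (hL : m ≤ L) :
    Run L eliminate s fun s' => (∀ i < k, ∀ j < i, ent n s' i j = 0) ∧
      (mat k (ent n s')).det = (mat k (ent n s)).det := by
  have hkL := h.size_le_rows.trans hL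
  refine (Run.forRange (fun t s' => (∀ c < t, ∀ i < k, c < i → ent n s' i c = 0) ∧
    (mat k (ent n s')).det = (mat k (ent n s)).det) (fun _ _ _ hi => hi) h.size hkL (a := 0) rfl
    (Nat.zero_le _) ⟨fun i hi => by omega, rfl⟩ ?_).imp ?_
  · rintro t _ ht s₁ hf₁ hx₁ ⟨hi₁, hdet⟩
    have h₁ := h.frame hf₁
    refine (Run.forRange (fun r s' => Cleared k t r (ent n s') ∧
      (mat k (ent n s')).det = (mat k (ent n s)).det) (fun _ _ _ hi => hi) h₁.size hkL
      (a := t + 1) (by simp [IExp.eval, hx₁]) ht ⟨⟨hi₁, fun i h1 h2 => by omega⟩, hdet⟩ ?_).imp ?_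
    · rintro r htr hr s₂ hf₂ hx₂ ⟨hc, hdet₂⟩
      refine (run_clearEntry (h₁.frame hf₂) hL ((hf₂.ivar 10 rfl).trans hx₁) hx₂ htr hr hc).imp
        fun s' _ hs' => ⟨hs'.1, hs'.2.trans hdet₂⟩
    · rintro s₂ _ ⟨hc, hdet₂⟩
      refine ⟨fun c hc' i hi hci => ?_, hdet₂⟩
      rcases Nat.lt_succ_iff_lt_or_eq.1 hc' with hlt | rfl
      exacts [hc.1 c hlt i hi hci, hc.2 i hci hi]
  · rintro s' _ ⟨hz, hdet⟩
    exact ⟨fun i hi j hj => hz j (hj.trans hi) i hi hj, hdet⟩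

theorem run_diagProduct (h : Ctx m n k α s) (hL : m ≤ L) :
    Run L diagProduct s fun s' => s'.rvar 0 = |∏ i ∈ Finset.range k, ent n s i i| := by
  refine Run.seq (Run.rset (Run.seq ?_))
  have h₀ : Ctx m n k α { s with rvar := Function.update s.rvar 0 (RExp.one.eval s) } :=
    ⟨h.rows, h.cols, h.size, h.sum, h.two, h.base, h.entries, h.size_le_rows, h.size_le_cols⟩
  refine (Run.forRange (fun t s' => s'.rvar 0 = ∏ i ∈ Finset.range t, ent n s i i)
    (fun _ _ _ hi => hi) h₀.size (h.size_le_rows.trans hL) (a := 0) rfl (Nat.zero_le _) ?_ ?_).imp ?_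
  · simp [RExp.eval]
  · intro t _ ht s₁ hf hx hi
    refine Run.rset ?_
    have hent : ent n s₁ t t = ent n s t t := by rw [ent, hf.rarr 1 rfl]; rfl
    simp only [RExp.eval, Function.update_self,
      (h₀.frame hf).eval_work hx (ht.trans_le h.size_le_rows) hx, hi, hent]
    rw [Finset.prod_range_succ]
  · intro s₁ _ hs₁
    refine Run.ite (fun hb => Run.rset ?_) (fun hb => Run.skip ?_)
    · simp only [Test.Holds, RExp.eval, hs₁] at hb
      simp only [RExp.eval, Function.update_self, hs₁, abs_of_neg hb, zero_sub]
    · simp only [Test.Holds, RExp.eval, hs₁, not_lt] at hb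
      rw [hs₁, abs_of_nonneg hb]

/-- The entries of the input, by row and column. -/
def entry (n : ℕ) (α : ℕ → ℝ) (i j : ℕ) : ℝ := α (n * i + j)

theorem run_computeAbsDet (h : Ctx m n k α s) (hL : m ≤ L)
    (hI : ∀ x < k, s.iarr 3 x < m ∧ s.iarr 4 x < n) :
    Run L computeAbsDet s fun s' =>
      s'.rvar 0 = absDet k (entry n α) (s.iarr 3) (s.iarr 4) := by
  refine Run.seq ((run_fillWork h hL hI).imp fun s₁ hf₁ hs₁ => ?_)
  have h₁ := h.frame hf₁
  refine Run.seq ((run_eliminate h₁ hL).imp fun s₂ hf₂ hs₂ => ?_)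
  have h₂ := h₁.frame hf₂
  refine (run_diagProduct h₂ hL).imp fun s₃ _ hs₃ => ?_
  have htri : (mat k (ent n s₂)).det = ∏ i : Fin k, mat k (ent n s₂) i i :=
    det_of_isUpperTriangular fun i j hij => hs₂.1 i i.2 j hij
  rw [hs₃, ← Fin.prod_univ_eq_prod_range (fun i => ent n s₂ i i)]
  change |∏ i : Fin k, mat k (ent n s₂) i i| = _
  rw [← htri, hs₂.2, absDet]
  congr 2
  exact mat_congr hs₁

end

end Subdet

/-! ### The local search -/

namespace Subdet

open RealRAM

/-- Lists of row and column indices: a pair `(I, J)` stands for the row indices `I 0, …, I (k - 1)`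
and the column indices `J 0, …, J (k - 1)`. -/
abbrev Slots : Type := (ℕ → ℕ) × (ℕ → ℕ)

/-- The absolute value of the subdeterminant listed by `S`. -/
noncomputable def val (k : ℕ) (a : ℕ → ℕ → ℝ) (S : Slots) : ℝ := absDet k a S.1 S.2

/-- The indices listed are indices of an `m × n` matrix. -/
def Valid (m n k : ℕ) (S : Slots) : Prop := ∀ x < k, S.1 x < m ∧ S.2 x < n

/-- Two lists agree in the first `k` slots. -/
def SlotEq (k : ℕ) (S T : Slots) : Prop := (∀ x < k, S.1 x = T.1 x) ∧ ∀ x < k, S.2 x = T.2 x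

/-- The move `(d, p, v)` writes `v` into slot `p` of the list of rows (if `d = 0`) or of columns (if
not); it does nothing when `v` is out of range.  The result may list an index twice; then its
determinant vanishes. -/
def move (m n d p v : ℕ) (S : Slots) : Slots :=
  if d = 0 then if v < m then (Function.update S.1 p v, S.2) else S
  else if v < n then (S.1, Function.update S.2 p v) else S

/-- In the first `k` slots, `T` results from `S` by two moves. -/
def Near (m n k : ℕ) (S T : Slots) : Prop :=
  ∃ d p v d' p' v', p < k ∧ p' < k ∧ SlotEq k T (move m n d' p' v' (move m n d p v S))

/-- A step of the local search on lists. -/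
def Improve (m n k : ℕ) (a : ℕ → ℕ → ℝ) (S T : Slots) : Prop :=
  Near m n k S T ∧ 2 * val k a S < val k a T

/-- No pair of moves more than doubles the subdeterminant. -/
def SlotMax (m n k : ℕ) (a : ℕ → ℕ → ℝ) (S : Slots) : Prop :=
  ∀ d < 2, ∀ p < k, ∀ v < m + n, ∀ d' < 2, ∀ p' < k, ∀ v' < m + n,
    val k a (move m n d' p' v' (move m n d p v S)) ≤ 2 * val k a S

/-- The output lists. -/
def slots (s : State) : Slots := (s.iarr 0, s.iarr 1)

/-- The working copies of the lists. -/
def trial (s : State) : Slots := (s.iarr 3, s.iarr 4)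

/-- Copies the lists in the integer arrays `a` and `a'` to the integer arrays `b` and `b'`. -/
def copySlots (a a' b b' : ℕ) : Prog :=
  forRange 13 (IExp.const 0) 3 (Prog.seq (Prog.iput b (IExp.var 13) (IExp.arr a (IExp.var 13)))
    (Prog.iput b' (IExp.var 13) (IExp.arr a' (IExp.var 13))))

/-- Evaluates the subdeterminant listed by the output lists. -/
def evaluate : Prog := Prog.seq (copySlots 0 1 3 4) computeAbsDet

/-- Applies the move whose components are the variables `x`, `y`, `z` to the working copies. -/
def moveTrial (x y z : ℕ) : Prog :=
  Prog.ite (Test.ilt (IExp.var x) (IExp.const 1))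
    (Prog.ite (Test.ilt (IExp.var z) (IExp.var 0)) (Prog.iput 3 (IExp.var y) (IExp.var z)) Prog.skip)
    (Prog.ite (Test.ilt (IExp.var z) (IExp.var 1)) (Prog.iput 4 (IExp.var y) (IExp.var z)) Prog.skip)

/-- Tries one pair of moves, and carries them out if they more than double the current value, which
is kept in the real variable `1`.  The integer variable `6` records whether there was a success. -/
def tryMoves : Prog :=
  Prog.seq (copySlots 0 1 3 4) (Prog.seq (moveTrial 20 21 22) (Prog.seq (moveTrial 23 24 25)
    (Prog.seq computeAbsDet
      (Prog.ite (Test.rlt (RExp.add (RExp.var 1) (RExp.var 1)) (RExp.var 0))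
        (Prog.seq (copySlots 3 4 0 1) (Prog.seq (Prog.rset 1 (RExp.var 0))
          (Prog.iset 6 (IExp.const 1)))) Prog.skip))))

/-- Tries all pairs of moves. -/
def sweep : Prog :=
  forRange 20 (IExp.const 0) 5 (forRange 21 (IExp.const 0) 3 (forRange 22 (IExp.const 0) 4
    (forRange 23 (IExp.const 0) 5 (forRange 24 (IExp.const 0) 3 (forRange 25 (IExp.const 0) 4
      tryMoves)))))

/-- The local search: sweeps until there is no success. -/
def localSearch : Prog :=
  Prog.seq evaluate (Prog.seq (Prog.rset 1 (RExp.var 0)) (Prog.seq (Prog.iset 6 (IExp.const 1))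
    (Prog.loop (Test.ilt (IExp.const 0) (IExp.var 6))
      (Prog.seq (Prog.iset 6 (IExp.const 0)) sweep))))

section

variable {m n k L : ℕ} {α : ℕ → ℝ} {s s' : State} {S T U : Slots} {a : ℕ → ℕ → ℝ}

theorem val_nonneg (k : ℕ) (a : ℕ → ℕ → ℝ) (S : Slots) : 0 ≤ val k a S := absDet_nonneg _ _ _ _

theorem SlotEq.val_eq (h : SlotEq k S T) : val k a S = val k a T := absDet_congr_slots h.1 h.2

theorem SlotEq.valid (h : SlotEq k S T) (hT : Valid m n k T) : Valid m n k S :=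
  fun x hx => by rw [h.1 x hx, h.2 x hx]; exact hT x hx

theorem Valid.move (h : Valid m n k S) (d p v : ℕ) : Valid m n k (move m n d p v S) := by
  intro x hx
  unfold Subdet.move
  have := h x hx
  split_ifs with h1 h2 h2
  · exact ⟨by simp only [Function.update_apply]; split_ifs <;> simp_all, this.2⟩
  · exact this
  · exact ⟨this.1, by simp only [Function.update_apply]; split_ifs <;> simp_all⟩
  · exact this

theorem SlotEq.move (h : SlotEq k S T) (d p v : ℕ) :
    SlotEq k (move m n d p v S) (move m n d p v T) := by
  constructor <;> intro x hx <;> have h1 := h.1 x hx <;> have h2 := h.2 x hx <;>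
    unfold Subdet.move <;> split_ifs <;> simp only [Function.update_apply, h1, h2]

theorem run_copySlots (h : Ctx m n k α s) (hL : m ≤ L) {a a' b b' : ℕ} (hab : a ≠ b) (hab' : a ≠ b')
    (ha'b : a' ≠ b) (ha'b' : a' ≠ b') (hbb : b ≠ b') :
    Run L (copySlots a a' b b') s fun s' =>
      SlotEq k (s'.iarr b, s'.iarr b') (s.iarr a, s.iarr a') := by
  refine Run.forRange (fun c s' => SlotEq c (s'.iarr b, s'.iarr b') (s.iarr a, s.iarr a'))
    (fun _ _ _ hi => hi) h.size (h.size_le_rows.trans hL) (a := 0) rfl (Nat.zero_le _)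
    ⟨fun x hx => by omega, fun x hx => by omega⟩ ?_
  intro c _ hc s₁ hf hx hi
  have ea : s₁.iarr a = s.iarr a := hf.iarr a (by
    simp [RealRAM.forRange, Prog.setsIArr, hab.symm, hab'.symm])
  have ea' : s₁.iarr a' = s.iarr a' := hf.iarr a' (by
    simp [RealRAM.forRange, Prog.setsIArr, ha'b.symm, ha'b'.symm])
  refine Run.seq (Run.iput (Run.iput ⟨fun x hx' => ?_, fun x hx' => ?_⟩))
  · simp only [IExp.eval, hx, Function.update_of_ne hbb, Function.update_self, ea]
    rcases Nat.lt_succ_iff_lt_or_eq.1 hx' with hlt | rfl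
    · rw [Function.update_of_ne hlt.ne]; exact hi.1 x hlt
    · rw [Function.update_self]
  · simp only [IExp.eval, hx, Function.update_of_ne hbb.symm, Function.update_self,
      Function.update_of_ne ha'b, ea']
    rcases Nat.lt_succ_iff_lt_or_eq.1 hx' with hlt | rfl
    · rw [Function.update_of_ne hlt.ne]; exact hi.2 x hlt
    · rw [Function.update_self]

theorem run_evaluate (h : Ctx m n k α s) (hL : m ≤ L) (hv : Valid m n k (slots s)) :
    Run L evaluate s fun s' => s'.rvar 0 = val k (entry n α) (slots s) := by
  refine Run.seq ((run_copySlots h hL (by decide) (by decide) (by decide) (by decide)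
    (by decide)).imp fun s₁ hf hs₁ => ?_)
  refine (run_computeAbsDet (h.frame hf) hL (hs₁.valid hv)).imp fun s₂ _ hs₂ => ?_
  exact hs₂.trans hs₁.val_eq

theorem run_moveTrial (h : Ctx m n k α s) (x y z : ℕ) :
    Run L (moveTrial x y z) s fun s' =>
      trial s' = move m n (s.ivar x) (s.ivar y) (s.ivar z) (trial s) := by
  unfold Subdet.move
  refine Run.ite (fun hb => ?_) (fun hb => ?_)
  · have hx : s.ivar x = 0 := by simp only [Test.Holds, IExp.eval] at hb; omega
    rw [if_pos hx]
    refine Run.ite (fun hb => Run.iput ?_) (fun hb => Run.skip ?_) <;>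
      simp only [Test.Holds, IExp.eval, h.rows] at hb
    · rw [if_pos hb]; simp [trial, IExp.eval]
    · rw [if_neg hb]
  · have hx : s.ivar x ≠ 0 := by simp only [Test.Holds, IExp.eval] at hb; omega
    rw [if_neg hx]
    refine Run.ite (fun hb => Run.iput ?_) (fun hb => Run.skip ?_) <;>
      simp only [Test.Holds, IExp.eval, h.cols] at hb
    · rw [if_pos hb]; simp [trial, IExp.eval]
    · rw [if_neg hb]

theorem run_tryMoves (h : Ctx m n k α s) (hL : m ≤ L) (hv : Valid m n k (slots s))
    (hcur : s.rvar 1 = val k (entry n α) (slots s)) {d p v d' p' v' : ℕ}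
    (hT : move m n d' p' v' (move m n d p v (slots s)) = T)
    (h20 : s.ivar 20 = d) (h21 : s.ivar 21 = p) (h22 : s.ivar 22 = v)
    (h23 : s.ivar 23 = d') (h24 : s.ivar 24 = p') (h25 : s.ivar 25 = v') :
    Run L tryMoves s fun s' =>
      (2 * val k (entry n α) (slots s) < val k (entry n α) T ∧ SlotEq k (slots s') T ∧
        s'.rvar 1 = val k (entry n α) (slots s') ∧ s'.ivar 6 = 1) ∨
      (val k (entry n α) T ≤ 2 * val k (entry n α) (slots s) ∧ slots s' = slots s ∧
        s'.rvar 1 = val k (entry n α) (slots s') ∧ s'.ivar 6 = s.ivar 6) := by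
  refine Run.seq ((run_copySlots h hL (by decide) (by decide) (by decide) (by decide)
    (by decide)).imp fun s₁ hf₁ hs₁ => ?_)
  have h₁ := h.frame hf₁
  refine Run.seq ((run_moveTrial h₁ 20 21 22).imp fun s₂ hf₂ hs₂ => ?_)
  have h₂ := h₁.frame hf₂
  refine Run.seq ((run_moveTrial h₂ 23 24 25).imp fun s₃ hf₃ hs₃ => ?_)
  have h₃ := h₂.frame hf₃
  rw [hf₂.ivar 23 rfl, hf₂.ivar 24 rfl, hf₂.ivar 25 rfl, hf₁.ivar 23 rfl, hf₁.ivar 24 rfl,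
    hf₁.ivar 25 rfl, hs₂, hf₁.ivar 20 rfl, hf₁.ivar 21 rfl, hf₁.ivar 22 rfl,
    h20, h21, h22, h23, h24, h25] at hs₃
  have hT₃ : SlotEq k (trial s₃) T := by
    rw [hs₃, ← hT]; exact SlotEq.move (SlotEq.move hs₁ _ _ _) _ _ _
  have hTv : Valid m n k (trial s₃) := hT₃.valid (hT ▸ (hv.move _ _ _).move _ _ _)
  refine Run.seq ((run_computeAbsDet h₃ hL hTv).imp fun s₄ hf₄ hs₄ => ?_)
  have h₄ := h₃.frame hf₄
  have hres : s₄.rvar 0 = val k (entry n α) T := hs₄.trans hT₃.val_eq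
  have hsl : slots s₄ = slots s := by
    unfold slots
    rw [hf₄.iarr 0 rfl, hf₃.iarr 0 rfl, hf₂.iarr 0 rfl, hf₁.iarr 0 rfl,
      hf₄.iarr 1 rfl, hf₃.iarr 1 rfl, hf₂.iarr 1 rfl, hf₁.iarr 1 rfl]
  have hcur₄ : s₄.rvar 1 = val k (entry n α) (slots s) := by
    rw [hf₄.rvar 1 rfl, hf₃.rvar 1 rfl, hf₂.rvar 1 rfl, hf₁.rvar 1 rfl, hcur]
  refine Run.ite (fun hb => ?_) (fun hb => Run.skip ?_) <;>
    simp only [Test.Holds, RExp.eval, hcur₄, hres, ← two_mul, not_lt] at hb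
  · refine Run.seq ((run_copySlots h₄ hL (by decide) (by decide) (by decide) (by decide)
      (by decide)).imp fun s₅ hf₅ hs₅ => Run.seq (Run.rset (Run.iset ?_)))
    have hT₄ : SlotEq k (trial s₄) T := by
      unfold trial at hT₃ ⊢
      rw [hf₄.iarr 3 rfl, hf₄.iarr 4 rfl]
      exact hT₃
    have hT₅ : SlotEq k (slots s₅) T :=
      ⟨fun x hx => (hs₅.1 x hx).trans (hT₄.1 x hx), fun x hx => (hs₅.2 x hx).trans (hT₄.2 x hx)⟩
    refine Or.inl ⟨hb, hT₅, ?_, ?_⟩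
    · simp only [Function.update_self, RExp.eval, hf₅.rvar 0 rfl, hres]
      exact hT₅.val_eq.symm
    · simp [IExp.eval]
  · refine Or.inr ⟨hb, hsl, hsl ▸ hcur₄, ?_⟩
    rw [hf₄.ivar 6 rfl, hf₃.ivar 6 rfl, hf₂.ivar 6 rfl, hf₁.ivar 6 rfl]

/-- The invariant of a sweep that starts at `S₀`: as long as there is no success, the statement `φ`
about the moves tried so far holds. -/
def SweepInv (m n k : ℕ) (α : ℕ → ℝ) (S₀ : Slots) (φ : Prop) (s : State) : Prop :=
  Valid m n k (slots s) ∧ s.rvar 1 = val k (entry n α) (slots s) ∧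
    ((s.ivar 6 = 0 ∧ slots s = S₀ ∧ φ) ∨
      (s.ivar 6 = 1 ∧ Relation.ReflTransGen (Improve m n k (entry n α)) S₀ (slots s) ∧
        2 * val k (entry n α) S₀ < val k (entry n α) (slots s)))

theorem SweepInv.imp {S₀ : Slots} {φ ψ : Prop} (h : SweepInv m n k α S₀ φ s) (hφ : φ → ψ) :
    SweepInv m n k α S₀ ψ s :=
  ⟨h.1, h.2.1, h.2.2.imp (fun h => ⟨h.1, h.2.1, hφ h.2.2⟩) id⟩

theorem run_tryMoves_sweepInv (h : Ctx m n k α s) (hL : m ≤ L) {S₀ : Slots} {φ : Prop}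
    (hi : SweepInv m n k α S₀ φ s) {d p v d' p' v' : ℕ} (hp : p < k) (hp' : p' < k)
    (h20 : s.ivar 20 = d) (h21 : s.ivar 21 = p) (h22 : s.ivar 22 = v)
    (h23 : s.ivar 23 = d') (h24 : s.ivar 24 = p') (h25 : s.ivar 25 = v') :
    Run L tryMoves s (SweepInv m n k α S₀ (φ ∧
      val k (entry n α) (move m n d' p' v' (move m n d p v S₀)) ≤
        2 * val k (entry n α) S₀)) := by
  refine (run_tryMoves h hL hi.1 hi.2.1 rfl h20 h21 h22 h23 h24 h25).imp fun s' _ hs' => ?_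
  rcases hs' with ⟨hlt, hT, hcur, hflag⟩ | ⟨hle, hsl, hcur, hflag⟩
  · have himp : Improve m n k (entry n α) (slots s) (slots s') :=
      ⟨⟨_, _, _, _, _, _, hp, hp', hT⟩, by rw [hT.val_eq]; exact hlt⟩
    refine ⟨hT.valid ((hi.1.move _ _ _).move _ _ _), hcur, Or.inr ⟨hflag, ?_, ?_⟩⟩
    · rcases hi.2.2 with ⟨_, h0, _⟩ | ⟨_, h0, _⟩
      · rw [← h0]; exact Relation.ReflTransGen.single himp
      · exact h0.tail himp
    · rcases hi.2.2 with ⟨_, h0, _⟩ | ⟨_, _, h0⟩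
      · rw [← h0]; exact himp.2
      · have := himp.2
        have := val_nonneg k (entry n α) (slots s)
        linarith
  · refine ⟨hsl ▸ hi.1, hcur, ?_⟩
    rw [hflag, hsl]
    rcases hi.2.2 with ⟨h1, h0, h2⟩ | h0
    · exact Or.inl ⟨h1, h0, h2, by rw [← h0]; exact hle⟩
    · exact Or.inr h0

/-- One level of the nest of loops in a sweep. -/
theorem run_forRange_sweepInv {S₀ : Slots} {φ : Prop} {ψ : ℕ → Prop} {x y N : ℕ} {body : Prog}
    (hi : SweepInv m n k α S₀ φ s) (hN : s.ivar y = N) (hL : N ≤ L)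
    (hbody : ∀ i < N, ∀ s' φ', Frame (forRange x (IExp.const 0) y body) s s' → s'.ivar x = i →
      SweepInv m n k α S₀ φ' s' → Run L body s' (SweepInv m n k α S₀ (φ' ∧ ψ i)))
    (hx6 : (6 : ℕ) ≠ x := by decide)
    (hx : body.setsIVar x = false := by rfl) (hy : body.setsIVar y = false := by rfl)
    (hxy : y ≠ x := by decide) :
    Run L (forRange x (IExp.const 0) y body) s (SweepInv m n k α S₀ (φ ∧ ∀ i < N, ψ i)) := by
  refine Run.forRange (fun j => SweepInv m n k α S₀ (φ ∧ ∀ i < j, ψ i)) ?_ hN hL (a := 0) rfl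
    (Nat.zero_le _) (hi.imp fun h => ⟨h, fun i hi => by omega⟩) ?_ hx hy hxy
  · rintro i s' v ⟨h1, h2, h3⟩
    refine ⟨h1, h2, ?_⟩
    simp only [Function.update_of_ne hx6]
    exact h3
  · intro i _ hiN s' hf hxi hs'
    refine (hbody i hiN s' _ hf hxi hs').imp fun s'' _ hs'' => hs''.imp ?_
    rintro ⟨⟨h1, h2⟩, h3⟩
    refine ⟨h1, fun j hj => ?_⟩
    rcases Nat.lt_succ_iff_lt_or_eq.1 hj with hlt | rfl
    exacts [h2 j hlt, h3]

theorem run_sweep (h : Ctx m n k α s) (hL : m + n + 2 ≤ L) {S₀ : Slots}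
    (hi : SweepInv m n k α S₀ True s) :
    Run L sweep s (SweepInv m n k α S₀ (SlotMax m n k (entry n α) S₀)) := by
  have hkL : k ≤ L := by have := h.size_le_rows; omega
  have key := run_forRange_sweepInv (x := 20) (y := 5)
    (body := forRange 21 (IExp.const 0) 3 (forRange 22 (IExp.const 0) 4
      (forRange 23 (IExp.const 0) 5 (forRange 24 (IExp.const 0) 3 (forRange 25 (IExp.const 0) 4
      tryMoves)))))
    (ψ := fun d => ∀ p < k, ∀ v < m + n, ∀ d' < 2, ∀ p' < k, ∀ v' < m + n,
      val k (entry n α) (move m n d' p' v' (move m n d p v S₀)) ≤ 2 * val k (entry n α) S₀)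
    hi h.two (L := L) (by omega) ?_
  · exact key.imp fun s' _ hs' => hs'.imp And.right
  intro d _ s₁ φ₁ hf₁ hd hi₁
  have h₁ := h.frame hf₁
  refine run_forRange_sweepInv hi₁ h₁.size hkL ?_
  intro p hp s₂ φ₂ hf₂ hp₂ hi₂
  have h₂ := h₁.frame hf₂
  refine run_forRange_sweepInv hi₂ h₂.sum (by omega) ?_
  intro v _ s₃ φ₃ hf₃ hv₃ hi₃
  have h₃ := h₂.frame hf₃
  refine run_forRange_sweepInv hi₃ h₃.two (by omega) ?_
  intro d' _ s₄ φ₄ hf₄ hd₄ hi₄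
  have h₄ := h₃.frame hf₄
  refine run_forRange_sweepInv hi₄ h₄.size hkL ?_
  intro p' hp' s₅ φ₅ hf₅ hp₅ hi₅
  have h₅ := h₄.frame hf₅
  refine run_forRange_sweepInv hi₅ h₅.sum (by omega) ?_
  intro v' _ s₆ φ₆ hf₆ hv₆ hi₆
  refine run_tryMoves_sweepInv (h₅.frame hf₆) (by omega) hi₆ hp hp' ?_ ?_ ?_ ?_ ?_ hv₆
  · rw [hf₆.ivar 20 rfl, hf₅.ivar 20 rfl, hf₄.ivar 20 rfl, hf₃.ivar 20 rfl, hf₂.ivar 20 rfl, hd]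
  · rw [hf₆.ivar 21 rfl, hf₅.ivar 21 rfl, hf₄.ivar 21 rfl, hf₃.ivar 21 rfl, hp₂]
  · rw [hf₆.ivar 22 rfl, hf₅.ivar 22 rfl, hf₄.ivar 22 rfl, hv₃]
  · rw [hf₆.ivar 23 rfl, hf₅.ivar 23 rfl, hd₄]
  · rw [hf₆.ivar 24 rfl, hp₅]

/-- From a start that is within a factor of `2 ^ e` of the maximum, the local search arrives at a
local maximum after at most `e + 1` sweeps, because each success doubles the value. -/
theorem run_localSearch (h : Ctx m n k α s) (hL : m + n + 2 ≤ L) {e : ℕ} (he : e + 1 ≤ L)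
    (hv : Valid m n k (slots s))
    (happrox : ∀ T, Valid m n k T →
      val k (entry n α) T ≤ 2 ^ e * val k (entry n α) (slots s)) :
    Run L localSearch s fun s' => Valid m n k (slots s') ∧
      Relation.ReflTransGen (Improve m n k (entry n α)) (slots s) (slots s') ∧
      SlotMax m n k (entry n α) (slots s') := by
  set a := entry n α
  refine Run.seq ((run_evaluate h (by omega) hv).imp fun s₁ hf₁ hs₁ =>
    Run.seq (Run.rset (Run.seq (Run.iset ?_))))
  have h₁ := h.frame hf₁
  have hsl : slots s₁ = slots s := by
    unfold slots
    rw [hf₁.iarr 0 rfl, hf₁.iarr 1 rfl]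
  refine (Run.loop (fun i s' => Ctx m n k α s' ∧ Valid m n k (slots s') ∧
    s'.rvar 1 = val k a (slots s') ∧
    Relation.ReflTransGen (Improve m n k a) (slots s) (slots s') ∧
    ((s'.ivar 6 = 0 ∧ SlotMax m n k a (slots s')) ∨
      (s'.ivar 6 = 1 ∧ ∃ j, i + j = e + 1 ∧ i ≠ 0 ∧
        2 ^ j * val k a (slots s) ≤ val k a (slots s')))) he ?_ ?_).imp ?_
  · refine ⟨⟨h₁.rows, h₁.cols, h₁.size, h₁.sum, h₁.two, h₁.base, h₁.entries, h₁.size_le_rows,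
      h₁.size_le_cols⟩, ?_, ?_, ?_, Or.inr ⟨by simp [IExp.eval], 0, rfl, by omega, ?_⟩⟩
    · change Valid m n k (slots s₁)
      rw [hsl]; exact hv
    · change _ = val k a (slots s₁)
      simp only [Function.update_self, RExp.eval, hs₁, hsl]
      rfl
    · change Relation.ReflTransGen _ _ (slots s₁)
      rw [hsl]
    · change _ ≤ val k a (slots s₁)
      rw [hsl, pow_zero, one_mul]
  · rintro i s₂ ⟨hctx, hv₂, hcur, hreach, hrest⟩ hb
    simp only [Test.Holds, IExp.eval] at hb
    obtain ⟨_, j, hij, hi0, hpow⟩ : s₂.ivar 6 = 1 ∧ ∃ j, i + j = e + 1 ∧ i ≠ 0 ∧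
        2 ^ j * val k a (slots s) ≤ val k a (slots s₂) := by
      rcases hrest with h0 | h0
      · omega
      · exact h0
    refine ⟨i - 1, by omega, Run.seq (Run.iset ?_)⟩
    have hctx' : Ctx m n k α { s₂ with
        ivar := Function.update s₂.ivar 6 ((IExp.const 0).eval s₂) } :=
      ⟨hctx.rows, hctx.cols, hctx.size, hctx.sum, hctx.two, hctx.base, hctx.entries,
        hctx.size_le_rows, hctx.size_le_cols⟩
    refine (run_sweep (S₀ := slots s₂) hctx' hL
      ⟨hv₂, hcur, Or.inl ⟨by simp [IExp.eval], rfl, trivial⟩⟩).imp fun s₃ hf hs₃ => ?_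
    refine ⟨hctx'.frame hf, hs₃.1, hs₃.2.1, ?_⟩
    rcases hs₃.2.2 with ⟨hfl, hS, hmax⟩ | ⟨hfl, hre, hlt⟩
    · rw [hS]
      exact ⟨hreach, Or.inl ⟨hfl, hmax⟩⟩
    · refine ⟨hreach.trans hre, Or.inr ⟨hfl, j + 1, by omega, ?_, ?_⟩⟩
      · -- a success in the last sweep would exceed the maximum
        intro hi1
        obtain rfl : j = e := by omega
        have := happrox _ hs₃.1
        have h0 := val_nonneg k a (slots s₂)
        linarith
      · rw [pow_succ]
        linarith
  · rintro s₂ _ ⟨hb, i, _, hv₂, _, hreach, hrest⟩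
    simp only [Test.Holds, IExp.eval] at hb
    refine ⟨hv₂, hreach, ?_⟩
    rcases hrest with h0 | h0
    · exact h0.2
    · omega

end

end Subdet

/-! ### The crude phase -/

namespace Subdet

open RealRAM

/-- Writes the best pair of a row and a column into slot `j` of the lists, where `j` is the integer
variable `27` and the size is `j + 1`. -/
def extend : Prog :=
  Prog.seq (Prog.iput 0 (IExp.var 27) (IExp.const 0)) (Prog.seq
    (Prog.iput 1 (IExp.var 27) (IExp.const 0)) (Prog.seq (Prog.rset 1 RExp.zero)
      (forRange 28 (IExp.const 0) 0 (forRange 29 (IExp.const 0) 1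
        (Prog.seq (copySlots 0 1 3 4) (Prog.seq (Prog.iput 3 (IExp.var 27) (IExp.var 28))
          (Prog.seq (Prog.iput 4 (IExp.var 27) (IExp.var 29)) (Prog.seq computeAbsDet
            (Prog.ite (Test.rlt (RExp.var 1) (RExp.var 0))
              (Prog.seq (Prog.iput 0 (IExp.var 27) (IExp.var 28))
                (Prog.seq (Prog.iput 1 (IExp.var 27) (IExp.var 29)) (Prog.rset 1 (RExp.var 0))))
              Prog.skip)))))))))

/-- Sets the loop bounds and the table of multiples of `n`. -/
def setup : Prog :=
  Prog.seq (Prog.iset 4 (IExp.add (IExp.var 0) (IExp.var 1))) (Prog.seq (Prog.iset 5 (IExp.const 2))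
    (Prog.seq (Prog.iset 3 (IExp.const 0)) (Prog.seq (Prog.iset 31 (IExp.const 0))
      (forRange 26 (IExp.const 0) 0 (Prog.seq (Prog.iput 2 (IExp.var 26) (IExp.var 31))
        (Prog.iset 31 (IExp.add (IExp.var 31) (IExp.var 1))))))))

/-- Builds up the lists: the lists of size `j` are improved to a local maximum and extended. -/
def build : Prog :=
  forRange 27 (IExp.const 0) 2 (Prog.seq localSearch
    (Prog.seq (Prog.iset 3 (IExp.add (IExp.var 27) (IExp.const 1))) extend))

/-- If the subdeterminant vanishes, resets the lists to `0, …, k - 1`, as they may list an index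
twice. -/
def repair : Prog :=
  Prog.seq evaluate (Prog.ite (Test.rlt RExp.zero (RExp.var 0)) Prog.skip
    (forRange 30 (IExp.const 0) 3 (Prog.seq (Prog.iput 0 (IExp.var 30) (IExp.var 30))
      (Prog.iput 1 (IExp.var 30) (IExp.var 30)))))

/-- The first phase of the algorithm. -/
def crudePhase : Prog := Prog.seq setup (Prog.seq build repair)

/-- The approximation factor reached at size `k` by the crude phase.  It is `1` for `k = 1`. -/
def growth (k : ℕ) : ℕ := (2 * k - 1).factorial * 6 ^ (k - 1)

theorem growth_le_two_pow (k : ℕ) : growth k ≤ 2 ^ (4 * k ^ 2 + 3 * k) := by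
  have h1 : (2 * k - 1).factorial ≤ 2 ^ (4 * k ^ 2) :=
    calc (2 * k - 1).factorial ≤ (2 * k).factorial := Nat.factorial_le (by omega)
      _ ≤ (2 * k) ^ (2 * k) := Nat.factorial_le_pow _
      _ ≤ (2 ^ (2 * k)) ^ (2 * k) := Nat.pow_le_pow_left Nat.lt_two_pow_self.le _
      _ = _ := by rw [← pow_mul]; ring_nf
  have h2 : 6 ^ (k - 1) ≤ 2 ^ (3 * k) :=
    calc 6 ^ (k - 1) ≤ 8 ^ (k - 1) := Nat.pow_le_pow_left (by norm_num) _
      _ ≤ 8 ^ k := Nat.pow_le_pow_right (by norm_num) (by omega)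
      _ = _ := by rw [pow_mul]; norm_num
  rw [pow_add]
  exact Nat.mul_le_mul h1 h2

section

variable {m n k L : ℕ} {α : ℕ → ℝ} {s s' : State} {S T U : Slots} {a : ℕ → ℕ → ℝ}

theorem run_extend {j : ℕ} (h : Ctx m n (j + 1) α s) (hL : m + n ≤ L) (hj : s.ivar 27 = j)
    (hv : Valid m n j (slots s)) :
    Run L extend s fun s' => SlotEq j (slots s') (slots s) ∧ Valid m n (j + 1) (slots s') ∧
      ∀ v < m, ∀ w < n, absDet (j + 1) (entry n α) (Function.update (slots s').1 j v)
        (Function.update (slots s').2 j w) ≤ val (j + 1) (entry n α) (slots s') := by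
  set a := entry n α
  have hm0 : 0 < m := by have := h.size_le_rows; omega
  have hn0 : 0 < n := by have := h.size_le_cols; omega
  let Base : State → Prop := fun s' => SlotEq j (slots s') (slots s) ∧
    ((slots s').1 j < m ∧ (slots s').2 j < n) ∧ s'.rvar 1 ≤ val (j + 1) a (slots s')
  let val' : ℕ → ℕ → ℝ := fun v w => absDet (j + 1) a (Function.update (slots s).1 j v)
    (Function.update (slots s).2 j w)
  have hupd : ∀ {I I' : ℕ → ℕ} {v : ℕ}, (∀ x < j, I x = I' x) →
      ∀ x < j + 1, Function.update I j v x = Function.update I' j v x := by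
    intro I I' v hI x hx
    simp only [Function.update_apply]
    split_ifs with hxj
    · rfl
    · exact hI x (by omega)
  have hstep : ∀ s₁ v w, Ctx m n (j + 1) α s₁ → s₁.ivar 27 = j → s₁.ivar 28 = v → s₁.ivar 29 = w →
      v < m → w < n → Base s₁ → Run L
        (Prog.seq (copySlots 0 1 3 4) (Prog.seq (Prog.iput 3 (IExp.var 27) (IExp.var 28))
          (Prog.seq (Prog.iput 4 (IExp.var 27) (IExp.var 29)) (Prog.seq computeAbsDet
            (Prog.ite (Test.rlt (RExp.var 1) (RExp.var 0))
              (Prog.seq (Prog.iput 0 (IExp.var 27) (IExp.var 28))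
                (Prog.seq (Prog.iput 1 (IExp.var 27) (IExp.var 29)) (Prog.rset 1 (RExp.var 0))))
              Prog.skip))))) s₁
        fun s' => Base s' ∧ s₁.rvar 1 ≤ s'.rvar 1 ∧ val' v w ≤ s'.rvar 1 := by
    rintro s₁ v w h₁ hj₁ hv₁ hw₁ hvm hwn ⟨hS, hr, hcur⟩
    refine Run.seq ((run_copySlots h₁ (by omega) (by decide) (by decide) (by decide) (by decide)
      (by decide)).imp fun s₂ hf₂ hs₂ => Run.seq (Run.iput (Run.seq (Run.iput (Run.seq ?_)))))
    have h₂ := h₁.frame hf₂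
    simp only [IExp.eval, hf₂.ivar 27 rfl, hf₂.ivar 28 rfl, hf₂.ivar 29 rfl, hj₁, hv₁, hw₁]
    generalize hs₃ : State.mk _ _ _ _ = s₃
    have h₃ : Ctx m n (j + 1) α s₃ := by
      subst hs₃
      exact ⟨h₂.rows, h₂.cols, h₂.size, h₂.sum, h₂.two, h₂.base, h₂.entries, h₂.size_le_rows,
        h₂.size_le_cols⟩
    have e3 : ∀ x < j + 1, s₃.iarr 3 x = Function.update (slots s).1 j v x := by
      intro x hx
      by_cases hxj : x = j
      · subst hs₃ hxj; simp
      · have h1 := (hs₂.1 x hx).trans (hS.1 x (by omega))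
        subst hs₃
        simpa [hxj] using h1
    have e4 : ∀ x < j + 1, s₃.iarr 4 x = Function.update (slots s).2 j w x := by
      intro x hx
      by_cases hxj : x = j
      · subst hs₃ hxj; simp
      · have h1 := (hs₂.2 x hx).trans (hS.2 x (by omega))
        subst hs₃
        simpa [hxj] using h1
    have hsl₃ : slots s₃ = slots s₁ := by
      have : slots s₃ = slots s₂ := by subst hs₃; simp [slots]
      rw [this, slots, slots, hf₂.iarr 0 rfl, hf₂.iarr 1 rfl]
    have hcur₃ : s₃.rvar 1 = s₁.rvar 1 := by
      rw [← hf₂.rvar 1 rfl]; subst hs₃; rfl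
    have i3 : s₃.ivar 27 = j ∧ s₃.ivar 28 = v ∧ s₃.ivar 29 = w := by
      subst hs₃
      exact ⟨(hf₂.ivar 27 rfl).trans hj₁, (hf₂.ivar 28 rfl).trans hv₁,
        (hf₂.ivar 29 rfl).trans hw₁⟩
    clear hs₃
    refine (run_computeAbsDet h₃ (by omega) ?_).imp fun s₄ hf₄ hs₄ => ?_
    · intro x hx
      rw [e3 x hx, e4 x hx]
      simp only [Function.update_apply]
      split_ifs with hxj
      · exact ⟨hvm, hwn⟩
      · exact hv x (by omega)
    have hres : s₄.rvar 0 = val' v w := hs₄.trans (absDet_congr_slots e3 e4)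
    have hcur₄ : s₄.rvar 1 = s₁.rvar 1 := (hf₄.rvar 1 rfl).trans hcur₃
    have hsl₄ : slots s₄ = slots s₁ := by
      rw [← hsl₃, slots, slots, hf₄.iarr 0 rfl, hf₄.iarr 1 rfl]
    refine Run.ite (fun hb => ?_) (fun hb => Run.skip ?_) <;>
      simp only [Test.Holds, RExp.eval, hcur₄, hres, not_lt] at hb
    · refine Run.seq (Run.iput (Run.seq (Run.iput (Run.rset ?_))))
      simp only [IExp.eval, RExp.eval, hf₄.ivar 27 rfl, hf₄.ivar 28 rfl, hf₄.ivar 29 rfl, i3.1,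
        i3.2.1, i3.2.2, hres, Function.update_self]
      have hsl₅ : ∀ (f : ℕ → ℝ) i r, slots ⟨i, f,
          Function.update (Function.update s₄.iarr 0 (Function.update (s₄.iarr 0) j v)) 1
            (Function.update (Function.update s₄.iarr 0 (Function.update (s₄.iarr 0) j v) 1) j w),
          r⟩ = (Function.update (slots s₁).1 j v, Function.update (slots s₁).2 j w) := by
        intro f i r
        rw [← hsl₄]; simp [slots]
      simp only [Base, hsl₅, Function.update_self]
      refine ⟨⟨⟨fun x hx => ?_, fun x hx => ?_⟩, ⟨hvm, hwn⟩, le_of_eq ?_⟩, hb.le, le_rfl⟩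
      · simp only [Function.update_of_ne hx.ne]; exact hS.1 x hx
      · simp only [Function.update_of_ne hx.ne]; exact hS.2 x hx
      · exact absDet_congr_slots (fun x hx => (hupd hS.1 x hx).symm)
          fun x hx => (hupd hS.2 x hx).symm
    · simp only [Base, hsl₄, hcur₄]
      exact ⟨⟨hS, hr, hcur⟩, le_rfl, hb⟩
  refine Run.seq (Run.iput (Run.seq (Run.iput (Run.seq (Run.rset ?_)))))
  simp only [IExp.eval, RExp.eval, hj]
  generalize hs₀ : State.mk _ _ _ _ = s₀
  have h₀ : Ctx m n (j + 1) α s₀ := by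
    subst hs₀
    exact ⟨h.rows, h.cols, h.size, h.sum, h.two, h.base, h.entries, h.size_le_rows,
      h.size_le_cols⟩
  have hj₀ : s₀.ivar 27 = j := by subst hs₀; exact hj
  have hb₀ : Base s₀ := by
    subst hs₀
    refine ⟨⟨fun x hx => ?_, fun x hx => ?_⟩, ⟨?_, ?_⟩, ?_⟩
    · simp [slots, Function.update_of_ne hx.ne]
    · simp [slots, Function.update_of_ne hx.ne]
    · simpa [slots] using hm0
    · simpa [slots] using hn0
    · simp only [Function.update_self]; exact val_nonneg _ _ _
  clear hs₀
  refine (Run.forRange (fun c s' => Base s' ∧ ∀ v < c, ∀ w < n, val' v w ≤ s'.rvar 1)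
    (fun _ _ _ hi => hi) h₀.rows (by omega) (a := 0) rfl (Nat.zero_le _)
    ⟨hb₀, fun v hv => by omega⟩ ?_).imp ?_
  · rintro v _ hvm s₁ hf₁ hv₁ ⟨hb₁, hi₁⟩
    have h₁ := h₀.frame hf₁
    refine (Run.forRange (fun c s' => Base s' ∧ (∀ v' < v, ∀ w < n, val' v' w ≤ s'.rvar 1) ∧
      ∀ w < c, val' v w ≤ s'.rvar 1) (fun _ _ _ hi => hi) h₁.cols (by omega) (a := 0) rfl
      (Nat.zero_le _) ⟨hb₁, hi₁, fun w hw => by omega⟩ ?_).imp ?_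
    · rintro w _ hwn s₂ hf₂ hw₂ ⟨hb₂, hi₂, hi₂'⟩
      refine (hstep s₂ v w (h₁.frame hf₂) ?_ ?_ hw₂ hvm hwn hb₂).imp ?_
      · rw [hf₂.ivar 27 rfl, hf₁.ivar 27 rfl, hj₀]
      · rw [hf₂.ivar 28 rfl, hv₁]
      · rintro s' _ ⟨hb, hle, hle'⟩
        refine ⟨hb, fun v' hv' w' hw' => (hi₂ v' hv' w' hw').trans hle, fun w' hw' => ?_⟩
        rcases Nat.lt_succ_iff_lt_or_eq.1 hw' with hlt | rfl
        exacts [(hi₂' w' hlt).trans hle, hle']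
    · rintro s' _ ⟨hb, hi, hi'⟩
      refine ⟨hb, fun v' hv' w hw => ?_⟩
      rcases Nat.lt_succ_iff_lt_or_eq.1 hv' with hlt | rfl
      exacts [hi v' hlt w hw, hi' w hw]
  · rintro s' _ ⟨⟨hS, hr, hcur⟩, hi⟩
    refine ⟨hS, fun x hx => ?_, fun v hv w hw => ?_⟩
    · rcases Nat.lt_succ_iff_lt_or_eq.1 hx with hlt | rfl
      · rw [hS.1 x hlt, hS.2 x hlt]; exact hv x hlt
      · exact hr
    · refine le_trans (le_of_eq ?_) ((hi v hv w hw).trans hcur)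
      exact absDet_congr_slots (hupd hS.1) (hupd hS.2)

theorem run_setup (hm : s.ivar 0 = m) (hn : s.ivar 1 = n) (hα : s.rarr 0 = α) (hL : m ≤ L) :
    Run L setup s (Ctx m n 0 α) := by
  refine Run.seq (Run.iset (Run.seq (Run.iset (Run.seq (Run.iset (Run.seq (Run.iset ?_)))))))
  simp only [IExp.eval, hm, hn]
  generalize hs₀ : State.mk _ _ _ _ = s₀
  have h₀ : s₀.ivar 0 = m ∧ s₀.ivar 1 = n ∧ s₀.ivar 3 = 0 ∧ s₀.ivar 4 = m + n ∧ s₀.ivar 5 = 2 ∧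
      s₀.ivar 31 = 0 ∧ s₀.rarr 0 = α := by
    subst hs₀
    simp [hm, hn, hα]
  clear hs₀
  refine (Run.forRange (fun c s' => s'.ivar 31 = n * c ∧ ∀ i < c, s'.iarr 2 i = n * i)
    (fun _ _ _ hi => ⟨(Function.update_of_ne (by decide) _ _).trans hi.1, hi.2⟩) h₀.1 hL (a := 0) rfl
    (Nat.zero_le _)
    ⟨h₀.2.2.2.2.2.1, fun i hi => by omega⟩ ?_).imp ?_
  · rintro i _ _ s₁ hf hx ⟨h31, hi⟩
    refine Run.seq (Run.iput (Run.iset ⟨?_, fun i' hi' => ?_⟩))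
    · simp only [IExp.eval, Function.update_self, h31, hf.ivar 1 rfl, h₀.2.1]
      ring
    · simp only [IExp.eval, Function.update_self, hx, h31, Function.update_apply]
      split_ifs with hii
      · rw [hii]
      · exact hi i' (by omega)
  · rintro s' hf ⟨_, hi⟩
    exact ⟨(hf.ivar 0 rfl).trans h₀.1, (hf.ivar 1 rfl).trans h₀.2.1, (hf.ivar 3 rfl).trans h₀.2.2.1,
      (hf.ivar 4 rfl).trans h₀.2.2.2.1, (hf.ivar 5 rfl).trans h₀.2.2.2.2.1, hi,
      (hf.rarr 0 rfl).trans h₀.2.2.2.2.2.2, Nat.zero_le _, Nat.zero_le _⟩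

theorem SlotMax.exchangeMax (h : SlotMax m n k a S) : ExchangeMax m n k a S.1 S.2 := by
  intro p hp q hq v hv w hw
  have := h 0 (by norm_num) p hp v (by omega) 1 (by norm_num) q hq w (by omega)
  simpa [move, hv, hw, val] using this

theorem val_le_of_reflTransGen (h : Relation.ReflTransGen (Improve m n k a) S T) :
    val k a S ≤ val k a T := by
  induction h with
  | refl => exact le_rfl
  | @tail T U _ hTU ih =>
    have h1 := hTU.2
    have h2 := val_nonneg k a T
    linarith

theorem det_ne_zero_of_val (h : val k a S ≠ 0) : (mat k fun x y => a (S.1 x) (S.2 y)).det ≠ 0 :=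
  abs_ne_zero.1 h

/-- The extension of a local maximum by the best pair of a row and a column. -/
theorem val_succ_le_growth (hmax : SlotMax m n k a S)
    (hzero : val k a S = 0 → ∀ T, Valid m n k T → val k a T = 0)
    (hST : SlotEq k T S) (hT : Valid m n (k + 1) T)
    (hext : ∀ v < m, ∀ w < n, absDet (k + 1) a (Function.update T.1 k v)
      (Function.update T.2 k w) ≤ val (k + 1) a T) (hU : Valid m n (k + 1) U) :
    val (k + 1) a U ≤ growth (k + 1) * val (k + 1) a T := by
  by_cases h0 : val k a S = 0
  · have : val (k + 1) a U = 0 := absDet_succ_eq_zero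
      (fun I J hIJ => hzero h0 (I, J) hIJ) U.1 U.2 hU
    rw [this]
    exact mul_nonneg (Nat.cast_nonneg _) (val_nonneg _ _ _)
  · have hmaxT : ExchangeMax m n k a T.1 T.2 := by
      intro p hp q hq v hv w hw
      have := hmax.exchangeMax p hp q hq v hv w hw
      rw [show absDet k a S.1 S.2 = absDet k a T.1 T.2 from hST.val_eq.symm] at this
      refine le_trans (le_of_eq (absDet_congr_slots ?_ ?_)) this <;> intro x hx <;>
        simp only [Function.update_apply, hST.1 x hx, hST.2 x hx]
    have := absDet_succ_le_of_exchangeMax (k := k) (a := a)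
      (det_ne_zero_of_val (by rwa [hST.val_eq])) (fun x hx => hT x (by omega)) hmaxT hU
      (hT k (by omega)) hext
    simpa [growth, mul_add, val] using this

theorem run_build (h : Ctx m n 0 α s) (hk : s.ivar 2 = k) (hkm : k ≤ m) (hkn : k ≤ n)
    (hL : 8 * (m + n + 1) ^ 2 ≤ L) :
    Run L build s fun s' => Ctx m n k α s' ∧ Valid m n k (slots s') ∧
      ∀ T, Valid m n k T → val k (entry n α) T ≤ growth k * val k (entry n α) (slots s') := by
  have hL' : m + n + 2 ≤ L := by nlinarith
  refine Run.forRange (fun i s' => Ctx m n i α s' ∧ Valid m n i (slots s') ∧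
    ∀ T, Valid m n i T → val i (entry n α) T ≤ growth i * val i (entry n α) (slots s'))
    ?_ hk (by omega) (a := 0) rfl (Nat.zero_le _) ?_ ?_
  · rintro i s' v ⟨h', h2⟩
    exact ⟨⟨h'.rows, h'.cols, h'.size, h'.sum, h'.two, h'.base, h'.entries, h'.size_le_rows,
      h'.size_le_cols⟩, h2⟩
  · refine ⟨h, fun x hx => by omega, fun T _ => ?_⟩
    simp [val, absDet_zero, growth]
  · rintro i _ hik s₁ _ hx₁ ⟨h₁, hv₁, happrox⟩
    have hpow : ∀ T, Valid m n i T → val i (entry n α) T ≤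
        2 ^ (4 * i ^ 2 + 3 * i) * val i (entry n α) (slots s₁) := by
      intro T hT
      refine (happrox T hT).trans (mul_le_mul_of_nonneg_right ?_ (val_nonneg _ _ _))
      exact_mod_cast growth_le_two_pow i
    have he : 4 * i ^ 2 + 3 * i + 1 ≤ L := by nlinarith
    refine Run.seq ((run_localSearch h₁ hL' he hv₁ hpow).imp fun s₂ hf₂ hs₂ =>
      Run.seq (Run.iset ?_))
    obtain ⟨hv₂, hreach, hmax⟩ := hs₂
    have h₂ := h₁.frame hf₂
    have hx₂ : s₂.ivar 27 = i := (hf₂.ivar 27 rfl).trans hx₁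
    simp only [IExp.eval, hx₂]
    have h₃ : Ctx m n (i + 1) α { s₂ with ivar := Function.update s₂.ivar 3 (i + 1) } :=
      ⟨h₂.rows, h₂.cols, Function.update_self 3 (i + 1) s₂.ivar, h₂.sum, h₂.two, h₂.base,
        h₂.entries, by omega, by omega⟩
    refine (run_extend h₃ (by omega) (j := i) hx₂ hv₂).imp fun s₄ hf₄ hs₄ => ?_
    obtain ⟨hS, hv₄, hext⟩ := hs₄
    refine ⟨h₃.frame hf₄, hv₄, fun U hU =>
      val_succ_le_growth hmax (fun h0 T hT => ?_) hS hv₄ hext hU⟩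
    have h5 : val i (entry n α) (slots s₁) = 0 :=
      le_antisymm ((val_le_of_reflTransGen hreach).trans h0.le) (val_nonneg _ _ _)
    have := hpow T hT
    rw [h5, mul_zero] at this
    exact le_antisymm this (val_nonneg _ _ _)

theorem run_repair (h : Ctx m n k α s) (hL : m ≤ L) (hv : Valid m n k (slots s)) :
    Run L repair s fun s' =>
      (val k (entry n α) (slots s) ≠ 0 ∧ slots s' = slots s) ∨
      (val k (entry n α) (slots s) = 0 ∧ SlotEq k (slots s') (id, id)) := by
  refine Run.seq ((run_evaluate h hL hv).imp fun s₁ hf₁ hs₁ => ?_)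
  have h₁ := h.frame hf₁
  refine Run.ite (fun hb => Run.skip ?_) (fun hb => ?_) <;>
    simp only [Test.Holds, RExp.eval, hs₁, not_lt] at hb
  · refine Or.inl ⟨hb.ne', ?_⟩
    rw [slots, slots, hf₁.iarr 0 rfl, hf₁.iarr 1 rfl]
  · refine (Run.forRange (fun c s' => SlotEq c (slots s') (id, id)) (fun _ _ _ hi => hi) h₁.size
      (h.size_le_rows.trans hL) (a := 0) rfl (Nat.zero_le _)
      ⟨fun x hx => by omega, fun x hx => by omega⟩ ?_).imp fun s' _ hs' =>
        Or.inr ⟨le_antisymm hb (val_nonneg _ _ _), hs'⟩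
    intro c _ _ s₂ _ hx hi
    refine Run.seq (Run.iput (Run.iput ?_))
    constructor <;> intro x hx' <;> by_cases hxc : x = c
    · simp [slots, IExp.eval, hx, hxc]
    · simpa [slots, IExp.eval, hx, hxc] using hi.1 x (by omega)
    · simp [slots, IExp.eval, hx, hxc]
    · simpa [slots, IExp.eval, hx, hxc] using hi.2 x (by omega)

theorem run_crudePhase (hm : s.ivar 0 = m) (hn : s.ivar 1 = n) (hk : s.ivar 2 = k)
    (hα : s.rarr 0 = α) (hkm : k ≤ m) (hkn : k ≤ n) (hL : 8 * (m + n + 1) ^ 2 ≤ L) :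
    Run L crudePhase s fun s' => Ctx m n k α s' ∧ Valid m n k (slots s') ∧
      (val k (entry n α) (slots s') ≠ 0 ∨ SlotEq k (slots s') (id, id)) ∧
      ∀ T, Valid m n k T → val k (entry n α) T ≤ growth k * val k (entry n α) (slots s') := by
  have hL' : m ≤ L := by nlinarith
  refine Run.seq ((run_setup hm hn hα hL').imp fun s₁ hf₁ h₁ => Run.seq
    ((run_build h₁ ((hf₁.ivar 2 rfl).trans hk) hkm hkn hL).imp fun s₂ _ hs₂ => ?_))
  obtain ⟨h₂, hv₂, happrox⟩ := hs₂
  refine (run_repair h₂ hL' hv₂).imp fun s₃ hf₃ hs₃ => ?_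
  rcases hs₃ with ⟨h0, hsl⟩ | ⟨h0, hid⟩
  · rw [hsl]
    exact ⟨h₂.frame hf₃, hv₂, Or.inl h0, happrox⟩
  · refine ⟨h₂.frame hf₃, hid.valid fun x hx => ⟨by simp only [id]; omega, by simp only [id]; omega⟩,
      Or.inr hid, fun T hT => ?_⟩
    refine (happrox T hT).trans ?_
    rw [h0, mul_zero]
    exact mul_nonneg (Nat.cast_nonneg _) (val_nonneg _ _ _)

end

end Subdet

/-! ### Lists of indices and index sets -/

namespace Subdet

open RealRAM Matrix

/-- The first `k` values of `f` list the `k`-element set `I`, without repetition. -/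
def ListsSet {m : ℕ} (k : ℕ) (f : ℕ → ℕ) (I : Finset (Fin m)) : Prop :=
  I.card = k ∧ (Finset.range k).image f = I.map Fin.valEmbedding

/-- The lists `S` list the index pair `X`. -/
def Lists {m n k : ℕ} (S : Slots) (X : Idx m n k) : Prop :=
  ListsSet k S.1 X.1.1 ∧ ListsSet k S.2 X.2.1

section

variable {m n k : ℕ} {f g : ℕ → ℕ} {I K : Finset (Fin m)}

theorem ListsSet.injOn (h : ListsSet k f I) : Set.InjOn f (Finset.range k) := by
  rw [← Finset.card_image_iff, h.2, Finset.card_map, h.1, Finset.card_range]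

theorem ListsSet.lt (h : ListsSet k f I) {x : ℕ} (hx : x < k) : f x < m := by
  have : f x ∈ I.map Fin.valEmbedding := h.2 ▸ Finset.mem_image_of_mem f (Finset.mem_range.2 hx)
  obtain ⟨i, _, hi⟩ := Finset.mem_map.1 this
  rw [← hi]; exact i.2

theorem ListsSet.mem (h : ListsSet k f I) {x : ℕ} (hx : x < k) : (⟨f x, h.lt hx⟩ : Fin m) ∈ I := by
  have : f x ∈ I.map Fin.valEmbedding := h.2 ▸ Finset.mem_image_of_mem f (Finset.mem_range.2 hx)
  obtain ⟨i, hi, hif⟩ := Finset.mem_map.1 this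
  convert hi
  exact hif.symm

theorem ListsSet.exists_slot (h : ListsSet k f I) {i : Fin m} (hi : i ∈ I) : ∃ x < k, f x = i := by
  have : (i : ℕ) ∈ (Finset.range k).image f := h.2 ▸ Finset.mem_map_of_mem Fin.valEmbedding hi
  simpa using this

theorem exists_listsSet (hf : Set.InjOn f (Finset.range k)) (hm : ∀ x < k, f x < m) :
    ∃ I : Finset (Fin m), ListsSet k f I := by
  have h : (Finset.range k).image f =
      (Finset.univ.filter fun i : Fin m => (i : ℕ) ∈ (Finset.range k).image f).map
        Fin.valEmbedding := by
    ext v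
    simp only [Finset.mem_map, Finset.mem_filter, Finset.mem_univ, true_and, Fin.valEmbedding_apply]
    refine ⟨fun hv => ?_, fun ⟨i, hi, hiv⟩ => hiv ▸ hi⟩
    obtain ⟨x, hx, rfl⟩ := Finset.mem_image.1 hv
    exact ⟨⟨f x, hm x (Finset.mem_range.1 hx)⟩, hv, rfl⟩
  refine ⟨_, ?_, h⟩
  rw [← Finset.card_map Fin.valEmbedding, ← h, Finset.card_image_of_injOn hf, Finset.card_range]

theorem exists_listsSet_of_card (hI : I.card = k) : ∃ f, ListsSet k f I := by
  refine ⟨fun x => if h : x < k then I.orderEmbOfFin hI ⟨x, h⟩ else 0, hI, ?_⟩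
  ext v
  simp only [Finset.mem_image, Finset.mem_range, Finset.mem_map, Fin.valEmbedding_apply]
  constructor
  · rintro ⟨x, hx, rfl⟩
    exact ⟨_, Finset.orderEmbOfFin_mem I hI ⟨x, hx⟩, by rw [dif_pos hx]⟩
  · rintro ⟨i, hi, rfl⟩
    have : i ∈ Set.range (I.orderEmbOfFin hI) := by rw [Finset.range_orderEmbOfFin]; exact hi
    obtain ⟨x, rfl⟩ := this
    exact ⟨x, x.2, by rw [dif_pos x.2]⟩

/-- A list differs from the increasing one by a permutation. -/
theorem ListsSet.exists_equiv (h : ListsSet k f I) :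
    ∃ e : Fin k ≃ Fin k, ∀ x : Fin k, f x = I.orderEmbOfFin h.1 (e x) := by
  have hx : ∀ x : Fin k, ∃ y, I.orderEmbOfFin h.1 y = ⟨f x, h.lt x.2⟩ := by
    intro x
    have : (⟨f x, h.lt x.2⟩ : Fin m) ∈ Set.range (I.orderEmbOfFin h.1) := by
      rw [Finset.range_orderEmbOfFin]; exact h.mem x.2
    exact this
  choose e he using hx
  have hinj : Function.Injective e := by
    intro x y hxy
    have h1 := (he x).symm.trans ((congrArg _ hxy).trans (he y))
    exact Fin.ext (h.injOn (by simp) (by simp) (Fin.mk.inj_iff.1 h1))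
  exact ⟨Equiv.ofBijective e (Finite.injective_iff_bijective.1 hinj), fun x =>
    (congrArg Fin.val (he x)).symm⟩

/-- Lists that differ in few slots list sets that differ in few elements. -/
theorem card_symmDiff_le (h : ListsSet k f I) (h' : ListsSet k g K) (R : Finset ℕ)
    (hR : ∀ x < k, x ∉ R → g x = f x) : (symmDiff I K).card / 2 ≤ R.card := by
  have h1 : (I \ K).card ≤ R.card := by
    rw [← Finset.card_map Fin.valEmbedding]
    refine (Finset.card_le_card (t := R.image f) fun v hv => ?_).trans Finset.card_image_le
    obtain ⟨i, hi, rfl⟩ := Finset.mem_map.1 hv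
    rw [Finset.mem_sdiff] at hi
    obtain ⟨x, hx, hxi⟩ := h.exists_slot hi.1
    refine Finset.mem_image.2 ⟨x, ?_, hxi⟩
    by_contra hxR
    refine hi.2 ?_
    convert h'.mem hx
    rw [hR x hx hxR, hxi]
  have h2 : (symmDiff I K).card ≤ (I \ K).card + (K \ I).card := by
    rw [symmDiff_def]; exact Finset.card_union_le _ _
  have h3 := Finset.card_sdiff_comm (h.1.trans h'.1.symm)
  omega

theorem card_sdiff_le_card_symmDiff (hI : I.card = k) (hK : K.card = k) :
    (I \ K).card ≤ (symmDiff I K).card / 2 := by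
  have h2 : (symmDiff I K).card = (I \ K).card + (K \ I).card := by
    rw [symmDiff_def]
    exact Finset.card_union_of_disjoint disjoint_sdiff_sdiff
  have h3 := Finset.card_sdiff_comm (hI.trans hK.symm)
  omega

/-- One exchange brings a set closer to `K`. -/
theorem ListsSet.exists_update (h : ListsSet k f I) (hK : K.card = k) (hk : 0 < k) {r : ℕ}
    (hr : (I \ K).card ≤ r + 1) :
    ∃ p < k, ∃ v < m, ∃ I' : Finset (Fin m),
      ListsSet k (Function.update f p v) I' ∧ (I' \ K).card ≤ r := by
  rcases (I \ K).eq_empty_or_nonempty with h0 | ⟨i, hi⟩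
  · refine ⟨0, hk, f 0, h.lt hk, I, ?_, ?_⟩
    · rwa [Function.update_eq_self]
    · rw [h0]; simp
  · have hcomm := Finset.card_sdiff_comm (h.1.trans hK.symm)
    obtain ⟨v, hv⟩ : (K \ I).Nonempty := by
      rw [← Finset.card_pos, ← hcomm]; exact Finset.card_pos.2 ⟨i, hi⟩
    have hI := (Finset.mem_sdiff.1 hi)
    have hvI := (Finset.mem_sdiff.1 hv)
    obtain ⟨p, hp, hpi⟩ := h.exists_slot hI.1
    refine ⟨p, hp, v, v.2, insert v (I.erase i), ⟨?_, ?_⟩, ?_⟩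
    · rw [Finset.card_insert_of_notMem fun hv' => hvI.2 (Finset.mem_of_mem_erase hv'),
        Finset.card_erase_of_mem hI.1, h.1]
      omega
    · ext w
      simp only [Finset.mem_image, Finset.mem_range, Finset.mem_map, Finset.mem_insert,
        Finset.mem_erase, Fin.valEmbedding_apply]
      constructor
      · rintro ⟨x, hx, rfl⟩
        by_cases hxp : x = p
        · exact ⟨v, Or.inl rfl, by rw [hxp, Function.update_self]⟩
        · refine ⟨⟨f x, h.lt hx⟩, Or.inr ⟨fun hxi => hxp ?_, h.mem hx⟩, by
            rw [Function.update_of_ne hxp]⟩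
          exact h.injOn (by simpa using hx) (by simpa using hp)
            ((congrArg Fin.val hxi).trans hpi.symm)
      · rintro ⟨u, rfl | ⟨hui, huI⟩, rfl⟩
        · exact ⟨p, hp, Function.update_self _ _ _⟩
        · obtain ⟨x, hx, hxu⟩ := h.exists_slot huI
          refine ⟨x, hx, ?_⟩
          rw [Function.update_of_ne, hxu]
          rintro rfl
          exact hui (Fin.ext (hxu.symm.trans hpi))
    · have : insert v (I.erase i) \ K = (I \ K).erase i := by
        ext u
        simp only [Finset.mem_sdiff, Finset.mem_insert, Finset.mem_erase]
        constructor
        · rintro ⟨rfl | h1, h2⟩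
          exacts [absurd hvI.1 h2, ⟨h1.1, h1.2, h2⟩]
        · rintro ⟨h1, h2, h3⟩
          exact ⟨Or.inr ⟨h1, h2⟩, h3⟩
      rw [this, Finset.card_erase_of_mem hi]
      omega

theorem ListsSet.eq_of_card_sdiff (h : ListsSet k f I) (hK : K.card = k) (h0 : (I \ K).card ≤ 0) :
    I = K := by
  have : I ⊆ K := by
    rw [← Finset.sdiff_eq_empty_iff_subset, ← Finset.card_eq_zero]; omega
  exact Finset.eq_of_subset_of_card_le this (by rw [hK, h.1])

end

/-! ### The two phases in terms of index sets -/

section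

variable {m n k : ℕ} {a : ℕ → ℕ → ℝ} {A : Matrix (Fin m) (Fin n) ℝ} {S T : Slots} {X Y : Idx m n k}

theorem Lists.valid (h : Lists S X) : Valid m n k S := fun _ hx => ⟨h.1.lt hx, h.2.lt hx⟩

theorem exists_lists_of_val_ne_zero (hS : Valid m n k S) (h0 : val k a S ≠ 0) :
    ∃ X : Idx m n k, Lists S X := by
  have hdet := det_ne_zero_of_val h0
  obtain ⟨I, hI⟩ := exists_listsSet (m := m) (f := S.1) (k := k) (fun x hx y hy hxy => by
    rw [Finset.mem_coe, Finset.mem_range] at hx hy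
    by_contra hne
    exact hdet (det_zero_of_row_eq (i := ⟨x, hx⟩) (j := ⟨y, hy⟩) (by simpa using hne)
      (by ext z; simp [mat, hxy]))) fun x hx => (hS x hx).1
  obtain ⟨J, hJ⟩ := exists_listsSet (m := n) (f := S.2) (k := k) (fun x hx y hy hxy => by
    rw [Finset.mem_coe, Finset.mem_range] at hx hy
    by_contra hne
    exact hdet (det_zero_of_column_eq (i := ⟨x, hx⟩) (j := ⟨y, hy⟩) (by simpa using hne)
      (fun z => by simp [mat, hxy]))) fun x hx => (hS x hx).2
  exact ⟨(⟨I, hI.1⟩, ⟨J, hJ.1⟩), hI, hJ⟩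

theorem exists_lists (X : Idx m n k) : ∃ S, Lists S X := by
  obtain ⟨f, hf⟩ := exists_listsSet_of_card X.1.2
  obtain ⟨g, hg⟩ := exists_listsSet_of_card X.2.2
  exact ⟨(f, g), hf, hg⟩

theorem exists_lists_id (hkm : k ≤ m) (hkn : k ≤ n) (hS : SlotEq k S (id, id)) :
    ∃ X : Idx m n k, Lists S X := by
  have hinj : ∀ f : ℕ → ℕ, (∀ x < k, f x = x) → Set.InjOn f (Finset.range k) := by
    intro f hf x hx y hy hxy
    rw [Finset.mem_coe, Finset.mem_range] at hx hy
    rwa [hf x hx, hf y hy] at hxy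
  obtain ⟨I, hI⟩ := exists_listsSet (m := m) (hinj S.1 hS.1)
    fun x hx => by rw [hS.1 x hx]; simp only [id]; omega
  obtain ⟨J, hJ⟩ := exists_listsSet (m := n) (hinj S.2 hS.2)
    fun x hx => by rw [hS.2 x hx]; simp only [id]; omega
  exact ⟨(⟨I, hI.1⟩, ⟨J, hJ.1⟩), hI, hJ⟩

variable (ha : ∀ (i : Fin m) (j : Fin n), a i j = A i j)
include ha

theorem Lists.abs_minor (h : Lists S X) : |minor A X| = val k a S := by
  obtain ⟨e, he⟩ := h.1.exists_equiv
  obtain ⟨e', he'⟩ := h.2.exists_equiv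
  rw [minor, ← abs_det_submatrix_equiv_equiv e e', val, absDet]
  congr 2
  ext x y
  simp [mat, he, he', ha]

theorem maxdet_le_mul [Nonempty (Idx m n k)] {B : ℝ}
    (h : ∀ T, Valid m n k T → val k a T ≤ B * val k a S) (hX : Lists S X) :
    maxdet k A ≤ B * |minor A X| := by
  refine ciSup_le fun Y => ?_
  obtain ⟨T, hT⟩ := exists_lists Y
  rw [hT.abs_minor ha, hX.abs_minor ha]
  exact h T hT.valid

theorem exists_searchStep (hX : Lists S X) (h : Improve m n k a S T) :
    ∃ Y : Idx m n k, Lists T Y ∧ SearchStep (1 / 2) A X Y := by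
  obtain ⟨⟨d, p, v, d', p', v', hp, hp', hT⟩, hlt⟩ := h
  have hTv : Valid m n k T := hT.valid ((hX.valid.move _ _ _).move _ _ _)
  have h0 := val_nonneg k a S
  obtain ⟨Y, hY⟩ := exists_lists_of_val_ne_zero (a := a) hTv (by linarith)
  refine ⟨Y, hY, ?_, by rw [hX.abs_minor ha, hY.abs_minor ha]; linarith⟩
  obtain ⟨R, C, hRC, hR, hC⟩ : ∃ R C : Finset ℕ, R.card + C.card ≤ 2 ∧
      (∀ x < k, x ∉ R → T.1 x = S.1 x) ∧ ∀ x < k, x ∉ C → T.2 x = S.2 x := by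
    have hrow : ∀ (d p v x : ℕ) (S : Slots), (d = 0 → x ≠ p) →
        (move m n d p v S).1 x = S.1 x := by
      intro d p v x S hx
      unfold move
      split_ifs <;> simp_all
    have hcol : ∀ (d p v x : ℕ) (S : Slots), (d ≠ 0 → x ≠ p) →
        (move m n d p v S).2 x = S.2 x := by
      intro d p v x S hx
      unfold move
      split_ifs <;> simp_all
    by_cases hd : d = 0 <;> by_cases hd' : d' = 0
    · exact ⟨{p, p'}, ∅, by simpa using Finset.card_le_two, fun x hx hxR => by
        rw [hT.1 x hx, hrow _ _ _ _ _ (by simp_all), hrow _ _ _ _ _ (by simp_all)],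
        fun x hx hxC => by
        rw [hT.2 x hx, hcol _ _ _ _ _ (by simp_all), hcol _ _ _ _ _ (by simp_all)]⟩
    · exact ⟨{p}, {p'}, by simp, fun x hx hxR => by
        rw [hT.1 x hx, hrow _ _ _ _ _ (by simp_all), hrow _ _ _ _ _ (by simp_all)],
        fun x hx hxC => by
        rw [hT.2 x hx, hcol _ _ _ _ _ (by simp_all), hcol _ _ _ _ _ (by simp_all)]⟩
    · exact ⟨{p'}, {p}, by simp, fun x hx hxR => by
        rw [hT.1 x hx, hrow _ _ _ _ _ (by simp_all), hrow _ _ _ _ _ (by simp_all)],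
        fun x hx hxC => by
        rw [hT.2 x hx, hcol _ _ _ _ _ (by simp_all), hcol _ _ _ _ _ (by simp_all)]⟩
    · exact ⟨∅, {p, p'}, by simpa using Finset.card_le_two, fun x hx hxR => by
        rw [hT.1 x hx, hrow _ _ _ _ _ (by simp_all), hrow _ _ _ _ _ (by simp_all)],
        fun x hx hxC => by
        rw [hT.2 x hx, hcol _ _ _ _ _ (by simp_all), hcol _ _ _ _ _ (by simp_all)]⟩
  exact (Nat.add_le_add (card_symmDiff_le hX.1 hY.1 R hR) (card_symmDiff_le hX.2 hY.2 C hC)).trans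
    hRC

theorem exists_reflTransGen_searchStep (hX : Lists S X)
    (h : Relation.ReflTransGen (Improve m n k a) S T) :
    ∃ Y : Idx m n k, Lists T Y ∧ Relation.ReflTransGen (SearchStep (1 / 2) A) X Y := by
  induction h with
  | refl => exact ⟨X, hX, Relation.ReflTransGen.refl⟩
  | tail _ hlast ih =>
    obtain ⟨Y, hY, hXY⟩ := ih
    obtain ⟨Z, hZ, hYZ⟩ := exists_searchStep ha hY hlast
    exact ⟨Z, hZ, hXY.tail hYZ⟩

theorem SlotMax.isLocalMax (hmax : SlotMax m n k a S) (hX : Lists S X) :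
    IsLocalMax 2 (1 / 2) A X := by
  intro Y hXY
  obtain ⟨U, hU⟩ := exists_lists Y
  rw [hX.abs_minor ha, hU.abs_minor ha]
  suffices val k a U ≤ 2 * val k a S by linarith
  rcases Nat.eq_zero_or_pos k with rfl | hk
  · simp [val, absDet_zero]
  have hr := card_sdiff_le_card_symmDiff X.1.2 Y.1.2
  have hc := card_sdiff_le_card_symmDiff X.2.2 Y.2.2
  unfold dist at hXY
  suffices h : ∃ d < 2, ∃ p < k, ∃ v < m + n, ∃ d' < 2, ∃ p' < k, ∃ v' < m + n,
      Lists (move m n d' p' v' (move m n d p v S)) Y by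
    obtain ⟨d, hd, p, hp, v, hv, d', hd', p', hp', v', hv', hL⟩ := h
    rw [← hU.abs_minor ha, hL.abs_minor ha]
    exact hmax d hd p hp v hv d' hd' p' hp' v' hv'
  by_cases hc0 : (X.2.1 \ Y.2.1).card ≤ 0
  · obtain ⟨p, hp, v, hv, I, hI, hIK⟩ := hX.1.exists_update Y.1.2 hk (r := 1) (by omega)
    obtain ⟨p', hp', v', hv', I', hI', hIK'⟩ := hI.exists_update Y.1.2 hk (r := 0) (by omega)
    refine ⟨0, by norm_num, p, hp, v, by omega, 0, by norm_num, p', hp', v', by omega, ?_⟩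
    have h1 := hI'.eq_of_card_sdiff Y.1.2 hIK'
    have h2 := hX.2.eq_of_card_sdiff Y.2.2 hc0
    simp only [move, reduceIte, hv, hv']
    exact ⟨h1 ▸ hI', h2 ▸ hX.2⟩
  by_cases hr0 : (X.1.1 \ Y.1.1).card ≤ 0
  · obtain ⟨p, hp, v, hv, I, hI, hIK⟩ := hX.2.exists_update Y.2.2 hk (r := 1) (by omega)
    obtain ⟨p', hp', v', hv', I', hI', hIK'⟩ := hI.exists_update Y.2.2 hk (r := 0) (by omega)
    refine ⟨1, by norm_num, p, hp, v, by omega, 1, by norm_num, p', hp', v', by omega, ?_⟩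
    have h1 := hI'.eq_of_card_sdiff Y.2.2 hIK'
    have h2 := hX.1.eq_of_card_sdiff Y.1.2 hr0
    simp only [move, one_ne_zero, reduceIte, hv, hv']
    exact ⟨h2 ▸ hX.1, h1 ▸ hI'⟩
  · obtain ⟨p, hp, v, hv, I, hI, hIK⟩ := hX.1.exists_update Y.1.2 hk (r := 0) (by omega)
    obtain ⟨p', hp', v', hv', I', hI', hIK'⟩ := hX.2.exists_update Y.2.2 hk (r := 0) (by omega)
    refine ⟨0, by norm_num, p, hp, v, by omega, 1, by norm_num, p', hp', v', by omega, ?_⟩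
    have h1 := hI.eq_of_card_sdiff Y.1.2 hIK
    have h2 := hI'.eq_of_card_sdiff Y.2.2 hIK'
    simp only [move, one_ne_zero, reduceIte, hv, hv']
    exact ⟨h1 ▸ hI, h2 ▸ hI'⟩

end

theorem factorial_mul_six_pow_le {k : ℕ} (hk : 2 ≤ k) : (2 * k).factorial * 6 ^ k ≤ k ^ (7 * k) := by
  have h1 : (2 * k).factorial ≤ k ^ (4 * k) :=
    calc (2 * k).factorial ≤ (2 * k) ^ (2 * k) := Nat.factorial_le_pow _
      _ ≤ (k ^ 2) ^ (2 * k) := Nat.pow_le_pow_left (by nlinarith) _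
      _ = _ := by rw [← pow_mul]; ring_nf
  have h2 : 6 ^ k ≤ k ^ (3 * k) :=
    calc 6 ^ k ≤ (2 ^ 3) ^ k := Nat.pow_le_pow_left (by norm_num) _
      _ ≤ (k ^ 3) ^ k := Nat.pow_le_pow_left (Nat.pow_le_pow_left hk _) _
      _ = _ := by rw [← pow_mul]
  calc _ ≤ k ^ (4 * k) * k ^ (3 * k) := Nat.mul_le_mul h1 h2
    _ = _ := by rw [← pow_add]; ring_nf

theorem growth_le_pow (k : ℕ) : growth k ≤ k ^ (7 * k) := by
  rcases Nat.lt_or_ge k 2 with hk | hk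
  · interval_cases k <;> decide
  · refine le_trans ?_ (factorial_mul_six_pow_le hk)
    exact Nat.mul_le_mul (Nat.factorial_le (by omega)) (Nat.pow_le_pow_right (by norm_num) (by omega))

/-- A local maximum that is at least as good as the outcome of the crude phase is within a factor of
`k ^ (7 * k)` of the maximum. -/
theorem val_le_pow_mul {m n k : ℕ} {a : ℕ → ℕ → ℝ} {S S₀ T : Slots} (hS : Valid m n k S)
    (hmax : SlotMax m n k a S) (hle : val k a S₀ ≤ val k a S)
    (happrox : ∀ T, Valid m n k T → val k a T ≤ growth k * val k a S₀) (hT : Valid m n k T) :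
    val k a T ≤ k ^ (7 * k) * val k a S := by
  by_cases hk : k < 2 ∨ val k a S = 0
  · refine (happrox T hT).trans ?_
    rcases hk with hk | h0
    · -- the crude phase finds the largest entry
      have hg : (growth k : ℝ) ≤ k ^ (7 * k) := by exact_mod_cast growth_le_pow k
      exact mul_le_mul hg hle (val_nonneg _ _ _) (by positivity)
    · rw [h0] at hle ⊢
      rw [le_antisymm hle (val_nonneg _ _ _), mul_zero, mul_zero]
  · push Not at hk
    refine (absDet_le_of_exchangeMax (det_ne_zero_of_val hk.2) hS hmax.exchangeMax hT).trans ?_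
    refine mul_le_mul_of_nonneg_right ?_ (val_nonneg k a S)
    exact_mod_cast factorial_mul_six_pow_le hk.1

theorem entry_input {m n : ℕ} (A : Matrix (Fin m) (Fin n) ℝ) (k : ℕ) (i : Fin m) (j : Fin n) :
    entry n ((input A k).rarr 0) i j = A i j := by
  have h : (n * i + j : ℕ) = (finProdFinEquiv (i, j) : Fin (m * n)) := by
    simp [finProdFinEquiv, add_comm]
  have hlt : (n * i + j : ℕ) < m * n := h ▸ Fin.is_lt _
  have heq : (⟨n * i + j, hlt⟩ : Fin (m * n)) = finProdFinEquiv (i, j) := Fin.ext h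
  simp only [entry, input, reduceIte, hlt, dif_pos, heq, Equiv.symm_apply_apply]

end Subdet

/-- The algorithm is the program `crude` followed by the program `search`. -/
theorem theorem1 :
    ∃ (crude search : RealRAM.Prog) (C : ℕ),
      ∀ (m n k : ℕ), k ≤ m → k ≤ n → ∀ A : Matrix (Fin m) (Fin n) ℝ,
        ∃ (s₀ s : RealRAM.State) (t₀ t : ℕ) (S₀ S : Subdet.Idx m n k),
          -- the run, and its length
          RealRAM.Exec crude (RealRAM.input A k) t₀ s₀ ∧
          RealRAM.Exec search s₀ t s ∧
          RealRAM.Exec (RealRAM.Prog.seq crude search) (RealRAM.input A k) (t₀ + t) s ∧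
          t₀ + t ≤ C * (m + n + 1) ^ C ∧
          -- the output, and its quality
          Subdet.Holds s S ∧
          Subdet.maxdet k A ≤ (k : ℝ) ^ (C * k) * |Subdet.minor A S| ∧
          -- a crude initial approximation
          Subdet.Holds s₀ S₀ ∧
          Subdet.maxdet k A ≤ ((m : ℝ) + n) ^ (C * k) * |Subdet.minor A S₀| ∧
          -- followed by a local search
          Relation.ReflTransGen (Subdet.SearchStep (1 / 2) A) S₀ S ∧
          Subdet.IsLocalMax 2 (1 / 2) A S := by
  open RealRAM Subdet in
  obtain ⟨c, e, htime⟩ := (Prog.seq crudePhase localSearch).exists_time_le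
  refine ⟨crudePhase, localSearch, c * 8 ^ e + 2 * e + 7, fun m n k hkm hkn A => ?_⟩
  set a := entry n ((input A k).rarr 0)
  have ha : ∀ (i : Fin m) (j : Fin n), a i j = A i j := entry_input A k
  set L := 8 * (m + n + 1) ^ 2 with hL
  have hL' : m + n + 2 ≤ L := by nlinarith
  obtain ⟨t₀, s₀, ht₀, hexec₀, hctx, hv₀, hinit, happrox⟩ :=
    run_crudePhase (s := input A k) (m := m) (n := n) (k := k) rfl rfl rfl rfl hkm hkn hL.ge
  have hpow : ∀ T, Valid m n k T →
      val k a T ≤ 2 ^ (4 * k ^ 2 + 3 * k) * val k a (slots s₀) := by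
    intro T hT
    refine (happrox T hT).trans (mul_le_mul_of_nonneg_right ?_ (val_nonneg _ _ _))
    exact_mod_cast growth_le_two_pow k
  obtain ⟨t, s, ht, hexec, hv, hreach, hmax⟩ :=
    run_localSearch hctx hL' (e := 4 * k ^ 2 + 3 * k) (by nlinarith) hv₀ hpow
  obtain ⟨S₀, hS₀⟩ : ∃ X : Idx m n k, Lists (slots s₀) X := by
    rcases hinit with h | h
    · exact exists_lists_of_val_ne_zero hv₀ h
    · exact exists_lists_id hkm hkn h
  obtain ⟨S, hS, hpath⟩ := exists_reflTransGen_searchStep ha hS₀ hreach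
  have : Nonempty (Idx m n k) := ⟨S⟩
  refine ⟨s₀, s, t₀, t, S₀, S, hexec₀, hexec, hexec₀.seq hexec, ?_, ⟨hS.1.2, hS.2.2⟩, ?_,
    ⟨hS₀.1.2, hS₀.2.2⟩, ?_, hpath, hmax.isLocalMax ha hS⟩
  · calc t₀ + t ≤ c * L ^ e := (Nat.add_le_add ht₀ ht).trans (htime L (by omega))
      _ = (c * 8 ^ e) * (m + n + 1) ^ (2 * e) := by rw [hL, mul_pow, ← pow_mul, mul_assoc]
      _ ≤ _ := Nat.mul_le_mul (by omega) (Nat.pow_le_pow_right (by omega) (by omega))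
  · refine maxdet_le_mul ha (fun T hT => ?_) hS
    refine (val_le_pow_mul hv hmax (val_le_of_reflTransGen hreach) happrox hT).trans
      (mul_le_mul_of_nonneg_right ?_ (val_nonneg _ _ _))
    rcases Nat.eq_zero_or_pos k with rfl | hk
    · simp
    · exact pow_le_pow_right₀ (by exact_mod_cast hk) (Nat.mul_le_mul_right _ (by omega))
  · refine maxdet_le_mul ha (fun T hT => ?_) hS₀
    refine (happrox T hT).trans (mul_le_mul_of_nonneg_right ?_ (val_nonneg _ _ _))
    rcases Nat.eq_zero_or_pos k with rfl | hk
    · simp [growth]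
    · have h1 : growth k ≤ (m + n) ^ ((c * 8 ^ e + 2 * e + 7) * k) :=
        calc growth k ≤ k ^ (7 * k) := growth_le_pow k
          _ ≤ (m + n) ^ (7 * k) := Nat.pow_le_pow_left (by omega) _
          _ ≤ _ := Nat.pow_le_pow_right (by omega) (Nat.mul_le_mul_right _ (by omega))
      exact_mod_cast h1
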